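/- Let $s>1$, $R>0$, $m,n\ge 0$, $N=m+n$, and write points of $\mathbb{R}^N=\mathbb{R}^m\times\mathbb{R}^n$ as $(x,t)$ and covectors as $(\sigma,\theta)$. Let $B_R^{\mathbb{R}^p}=\{y\in\mathbb{R}^p:|y|<R\}$, $V=B_R^{\mathbb{R}^m}\times B_R^{\mathbb{R}^n}$, and let $W\subseteq\mathbb{R}^N$ be an open set with $\overline V\subset W$. For $h>0$ and a set $K$ put $\|f\|_{h,K}=\sup_{\alpha}\frac{1}{h^{|\alpha|}\alpha!^s}\sup_{K}|\partial^\alpha f|$. For $\Omega$ open, $G^s(\Omega)$ is the space of $f\in C^\infty(\Omega)$ such that for every compact $K\subset\Omega$ there is $h>0$ with $\|f\|_{h,K}<\infty$; $G^s_c(\Omega)$ is the subspace of functions with compact support in $\Omega$ (extended by $0$); and $\mathcal{D}'_s(\Omega)$ is the space of linear functionals $u$ on $G^s_c(\Omega)$ such that for every compact $K\subset\Omega$ and every $h>0$ there is $C$ with $|u(\varphi)|\le C\|\varphi\|_{h,K}$ for all $\varphi\in G^s_c(\Omega)$ with $\operatorname{supp}\varphi\subset K$ and $\|\varphi\|_{h,K}<\infty$.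 For $u\in\mathcal{D}'_s(\Omega)$ and $\chi\in G^s_c(\Omega)$ put $\mathcal{F}(\chi u)(\xi)=u(\chi\, e^{-i\langle\cdot,\xi\rangle})$. A point $(y_0,\xi_0)\in\Omega\times(\mathbb{R}^N\setminus 0)$ is outside the Gevrey wave-front set $WF_s(u)$ if there are $\chi\in G^s_c(\Omega)$ equal to $1$ near $y_0$, an open cone $\Gamma\ni\xi_0$ and $C,\varepsilon>0$ with $|\mathcal{F}(\chi u)(\xi)|\le Ce^{-\varepsilon|\xi|^{1/s}}$ for $\xi\in\Gamma$. Let $u\in\mathcal{D}'_s(W)$ satisfy $$WF_s(u)\cap\{(x,t,0,\theta):(x,t)\in W,\ \theta\ne0\}=\emptyset,$$ and let $\lambda\in G^s_c(W)$ be equal to $1$ on $V$. For $t\in B_R^{\mathbb{R}^n}$ and $\varphi\in G^s_c(B_R^{\mathbb{R}^m})$ put $$(\iota_t^*u)(\varphi)=\frac1{(2\pi)^N}\int_{\mathbb{R}^N}\mathcal{F}(\lambda u)(\sigma,\theta)\,e^{i\langle t,\theta\rangle}\Big(\int_{\mathbb{R}^m}\varphi(x)e^{i\langle x,\sigma\rangle}\,dx\Big)\,d\sigma\,d\theta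 .\qquad(\mathrm{TRACE})$$ Then: 1. for every $t\in B_R^{\mathbb{R}^n}$ and $\varphi\in G^s_c(B_R^{\mathbb{R}^m})$ the integral over $\mathbb{R}^N$ in (TRACE) converges absolutely; 2. for every $t\in B_R^{\mathbb{R}^n}$, $\iota_t^*u\in\mathcal{D}'_s(B_R^{\mathbb{R}^m})$; 3. for every $\varphi\in G^s_c(B_R^{\mathbb{R}^m})$ the function $t\mapsto(\iota_t^*u)(\varphi)$ belongs to $G^s(B_R^{\mathbb{R}^n})$; 4. for every $r>0$ there are $C\ge 0$ and $b>0$ such that, for all $\varphi\in G^s_c(B_R^{\mathbb{R}^m})$ with $\|\varphi\|_{r,B_R^{\mathbb{R}^m}}<\infty$, all $\beta\in\mathbb{Z}_+^n$ and all $t\in B_R^{\mathbb{R}^n}$, $$\big|\partial_t^\beta\big((\iota_t^*u)(\varphi)\big)\big|\le C\,\|\varphi\|_{r,B_R^{\mathbb{R}^m}}\,b^{|\beta|}\,|\beta|!^s .$$ -/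

import Mathlib

open Set MeasureTheory Topology
open scoped ContDiff ENNReal NNReal

/-- The list of coordinate directions of the multi-index `α`: each `i` occurs `α i` times. -/
noncomputable def multiIndexWord {ι : Type*} [Fintype ι] (α : ι → ℕ) : List ι :=
  Finset.univ.toList.flatMap fun i => List.replicate (α i) i

/-- The partial derivative `∂^α f (x)` of a (smooth) function on `ℝ^ι`, for a multi-index `α`. -/
noncomputable def multiDeriv {ι : Type*} [Fintype ι] (α : ι → ℕ)
    (f : EuclideanSpace ℝ ι → ℂ) (x : EuclideanSpace ℝ ι) : ℂ :=
  iteratedFDeriv ℝ (multiIndexWord α).length f x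
    fun j => EuclideanSpace.basisFun ι ℝ ((multiIndexWord α).get j)

/-- The length `|α|` of a multi-index. -/
def multiAbs {ι : Type*} [Fintype ι] (α : ι → ℕ) : ℕ := ∑ i, α i

/-- The factorial `α!` of a multi-index. -/
def multiFactorial {ι : Type*} [Fintype ι] (α : ι → ℕ) : ℕ := ∏ i, (α i).factorial

/-- The Gevrey norm
`‖f‖_{h,K} = sup_α (h^{|α|} α!^s)⁻¹ sup_{x ∈ K} |∂^α f (x)|`, with values in `[0, ∞]`. -/
noncomputable def gevreyNorm {ι : Type*} [Fintype ι] (s h : ℝ) (K : Set (EuclideanSpace ℝ ι))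
    (f : EuclideanSpace ℝ ι → ℂ) : ℝ≥0∞ :=
  ⨆ α : ι → ℕ, (⨆ x ∈ K, ‖multiDeriv α f x‖ₑ) /
    ENNReal.ofReal (h ^ multiAbs α * (multiFactorial α : ℝ) ^ s)

/-- `f ∈ G^s(Ω)`, for an open set `Ω`. -/
def IsGevreyOn {ι : Type*} [Fintype ι] (s : ℝ) (Ω : Set (EuclideanSpace ℝ ι))
    (f : EuclideanSpace ℝ ι → ℂ) : Prop :=
  ContDiffOn ℝ ∞ f Ω ∧ ∀ K ⊆ Ω, IsCompact K → ∃ h : ℝ, 0 < h ∧ gevreyNorm s h K f < ⊤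

section Helpers

variable {ι : Type*} [Fintype ι]

theorem count_multiIndexWord [DecidableEq ι] (α : ι → ℕ) (i : ι) :
    (multiIndexWord α).count i = α i := by
  unfold multiIndexWord
  rw [List.count_flatMap]
  have h : (List.count i ∘ fun j => List.replicate (α j) j) = fun j => if j = i then α j else 0 := by
    funext j
    simp [List.count_replicate]
  rw [h, Finset.sum_map_toList]
  simp

theorem length_multiIndexWord (α : ι → ℕ) : (multiIndexWord α).length = multiAbs α := by
  simp [multiIndexWord, multiAbs, List.length_flatMap]

theorem gevreyNorm_lt_top_iff {s h : ℝ} (hh : 0 < h) (K : Set (EuclideanSpace ℝ ι))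
    (f : EuclideanSpace ℝ ι → ℂ) :
    gevreyNorm s h K f < ⊤ ↔ ∃ C : ℝ, 0 ≤ C ∧ ∀ α, ∀ x ∈ K,
      ‖multiDeriv α f x‖ ≤ C * (h ^ multiAbs α * (multiFactorial α : ℝ) ^ s) := by
  have hpos : ∀ α : ι → ℕ, 0 < h ^ multiAbs α * (multiFactorial α : ℝ) ^ s := by
    intro α
    have : 0 < multiFactorial α := Finset.prod_pos fun i _ => Nat.factorial_pos _
    positivity
  constructor
  · intro hlt
    refine ⟨(gevreyNorm s h K f).toReal, ENNReal.toReal_nonneg, fun α x hx => ?_⟩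
    have h1 : ‖multiDeriv α f x‖ₑ / ENNReal.ofReal (h ^ multiAbs α * (multiFactorial α : ℝ) ^ s)
        ≤ gevreyNorm s h K f := by
      refine le_trans ?_ (le_iSup (fun α : ι → ℕ => (⨆ x ∈ K, ‖multiDeriv α f x‖ₑ) /
        ENNReal.ofReal (h ^ multiAbs α * (multiFactorial α : ℝ) ^ s)) α)
      gcongr
      exact le_iSup₂ (f := fun x (_ : x ∈ K) => ‖multiDeriv α f x‖ₑ) x hx
    rw [ENNReal.div_le_iff (by simpa using hpos α) ENNReal.ofReal_ne_top] at h1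
    have h2 := ENNReal.toReal_mono (ENNReal.mul_ne_top hlt.ne ENNReal.ofReal_ne_top) h1
    rwa [toReal_enorm, ENNReal.toReal_mul, ENNReal.toReal_ofReal (hpos α).le] at h2
  · rintro ⟨C, hC, hb⟩
    refine lt_of_le_of_lt (iSup_le fun α => ?_) (ENNReal.ofReal_lt_top (r := C))
    rw [ENNReal.div_le_iff (by simpa using hpos α) ENNReal.ofReal_ne_top,
      ← ENNReal.ofReal_mul hC]
    refine iSup₂_le fun x hx => ?_
    rw [← ofReal_norm]
    exact ENNReal.ofReal_le_ofReal (hb α x hx)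

theorem norm_multiDeriv_le (α : ι → ℕ) (f : EuclideanSpace ℝ ι → ℂ) (x : EuclideanSpace ℝ ι) :
    ‖multiDeriv α f x‖ ≤ ‖iteratedFDeriv ℝ (multiAbs α) f x‖ := by
  rw [← length_multiIndexWord]
  refine (ContinuousMultilinearMap.le_opNorm _ _).trans ?_
  simp

/-- The partial derivative along a list of coordinate directions. -/
noncomputable def wordDeriv (l : List ι) (f : EuclideanSpace ℝ ι → ℂ)
    (x : EuclideanSpace ℝ ι) : ℂ :=
  iteratedFDeriv ℝ l.length f x fun j => EuclideanSpace.basisFun ι ℝ (l.get j)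

theorem contDiff_wordDeriv {f : EuclideanSpace ℝ ι → ℂ} (hf : ContDiff ℝ ∞ f) (l : List ι) :
    ContDiff ℝ ∞ (wordDeriv l f) := by
  have h := hf.iteratedFDeriv_right (m := ∞) (i := l.length) (by exact_mod_cast (le_top : (⊤ + (l.length : ℕ∞)) ≤ ⊤))
  exact (ContinuousMultilinearMap.apply ℝ (fun _ : Fin l.length => EuclideanSpace ℝ ι) ℂ
    (fun j => EuclideanSpace.basisFun ι ℝ (l.get j))).contDiff.comp h

theorem wordDeriv_cons {f : EuclideanSpace ℝ ι → ℂ} (hf : ContDiff ℝ ∞ f) (i : ι) (l : List ι)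
    (x : EuclideanSpace ℝ ι) :
    wordDeriv (i :: l) f x = fderiv ℝ (wordDeriv l f) x (EuclideanSpace.basisFun ι ℝ i) := by
  have h := hf.iteratedFDeriv_right (m := ∞) (i := l.length) (by exact_mod_cast (le_top : (⊤ + (l.length : ℕ∞)) ≤ ⊤))
  have hd : HasFDerivAt (iteratedFDeriv ℝ l.length f)
      (fderiv ℝ (iteratedFDeriv ℝ l.length f) x) x :=
    (h.differentiable (by simp) x).hasFDerivAt
  have h2 := (ContinuousMultilinearMap.apply ℝ (fun _ : Fin l.length => EuclideanSpace ℝ ι) ℂ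
    (fun j => EuclideanSpace.basisFun ι ℝ (l.get j))).hasFDerivAt.comp x hd
  have h3 : fderiv ℝ (wordDeriv l f) x = _ := h2.fderiv
  rw [h3]
  rfl

theorem wordDeriv_perm {f : EuclideanSpace ℝ ι → ℂ} (hf : ContDiff ℝ ∞ f) {l l' : List ι}
    (h : l.Perm l') : wordDeriv l f = wordDeriv l' f := by
  induction h with
  | nil => rfl
  | cons i _ ih => funext x; rw [wordDeriv_cons hf, wordDeriv_cons hf, ih]
  | trans _ _ ih1 ih2 => exact ih1.trans ih2
  | swap i j l =>
    funext x
    have hg := contDiff_wordDeriv hf l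
    have hD : Differentiable ℝ (fderiv ℝ (wordDeriv l f)) :=
      (hg.fderiv_right (m := ∞) (by simp)).differentiable (by simp)
    have key : ∀ a b : ι, wordDeriv (a :: b :: l) f x =
        fderiv ℝ (fderiv ℝ (wordDeriv l f)) x (EuclideanSpace.basisFun ι ℝ a)
          (EuclideanSpace.basisFun ι ℝ b) := by
      intro a b
      rw [wordDeriv_cons hf]
      have h1 : wordDeriv (b :: l) f =
          fun y => fderiv ℝ (wordDeriv l f) y (EuclideanSpace.basisFun ι ℝ b) :=
        funext fun y => wordDeriv_cons hf b l y
      rw [h1, ((hD x).hasFDerivAt.clm_apply (hasFDerivAt_const _ x)).fderiv]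
      simp
    rw [key, key]
    exact (hg.contDiffAt.isSymmSndFDerivAt
      (by rw [minSmoothness_of_isRCLikeNormedField]; exact WithTop.coe_le_coe.2 (le_top : (2 : ℕ∞) ≤ ⊤))).eq _ _

theorem iteratedFDeriv_word_eq_multiDeriv {f : EuclideanSpace ℝ ι → ℂ}
    (hf : ContDiff ℝ ∞ f) (x : EuclideanSpace ℝ ι) {k : ℕ} (I : Fin k → ι) :
    ∃ α : ι → ℕ, multiAbs α = k ∧
      iteratedFDeriv ℝ k f x (fun j => EuclideanSpace.basisFun ι ℝ (I j)) = multiDeriv α f x := by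
  classical
  obtain ⟨l, rfl, hl⟩ : ∃ l : List ι, ∃ h : l.length = k, ∀ j, l.get j = I (j.cast h) :=
    ⟨List.ofFn I, List.length_ofFn, fun j => List.get_ofFn I j⟩
  have hperm : l.Perm (multiIndexWord fun i => l.count i) :=
    List.perm_iff_count.2 fun i => (count_multiIndexWord (fun i => l.count i) i).symm
  refine ⟨fun i => l.count i, by rw [← length_multiIndexWord, hperm.length_eq], ?_⟩
  have hI : I = fun j => l.get j := funext fun j => (hl j).symm
  rw [hI]
  exact congrFun (wordDeriv_perm hf hperm) x

theorem multiFactorial_le (α : ι → ℕ) : multiFactorial α ≤ (multiAbs α).factorial :=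
  Nat.le_of_dvd (Nat.factorial_pos _) (Nat.prod_factorial_dvd_factorial_sum _ _)

theorem factorial_multiAbs_le (α : ι → ℕ) :
    (multiAbs α).factorial ≤ (Fintype.card ι + 1) ^ multiAbs α * multiFactorial α := by
  classical
  have h1 : (Finset.univ : Finset ι).prod (fun i => (α i).factorial) * Nat.multinomial Finset.univ α
      = (multiAbs α).factorial := Nat.multinomial_spec _ _
  have h2 : Nat.multinomial Finset.univ α ≤ (Fintype.card ι) ^ multiAbs α := by
    have := Finset.sum_pow_eq_sum_piAntidiag (Finset.univ : Finset ι) (fun _ => (1 : ℕ)) (multiAbs α)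
    simp only [Finset.sum_const, Finset.card_univ, smul_eq_mul, mul_one, one_pow,
      Finset.prod_const_one] at this
    rw [this]
    refine Finset.single_le_sum (f := fun k : ι → ℕ => Nat.multinomial Finset.univ k)
      (fun _ _ => Nat.zero_le _) ?_
    simp [multiAbs]
  rw [← h1, mul_comm]
  refine Nat.mul_le_mul_right _ (h2.trans (Nat.pow_le_pow_left (Nat.le_succ _) _))

theorem norm_iteratedFDeriv_le_of_multiDeriv {f : EuclideanSpace ℝ ι → ℂ} (hf : ContDiff ℝ ∞ f)
    (x : EuclideanSpace ℝ ι) (k : ℕ) {M : ℝ} (hM : 0 ≤ M)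
    (h : ∀ α : ι → ℕ, multiAbs α = k → ‖multiDeriv α f x‖ ≤ M) :
    ‖iteratedFDeriv ℝ k f x‖ ≤ (Fintype.card ι + 1 : ℝ) ^ k * M := by
  classical
  refine ContinuousMultilinearMap.opNorm_le_bound (by positivity) fun v => ?_
  have hv : v = fun j => ∑ i, (v j) i • EuclideanSpace.basisFun ι ℝ i := by
    funext j
    simpa using ((EuclideanSpace.basisFun ι ℝ).sum_repr (v j)).symm
  conv_lhs => rw [hv]
  rw [ContinuousMultilinearMap.map_sum]
  refine (norm_sum_le _ _).trans ?_
  have hb : ∀ I ∈ (Finset.univ : Finset (Fin k → ι)),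
      ‖iteratedFDeriv ℝ k f x (fun j => (v j) (I j) • EuclideanSpace.basisFun ι ℝ (I j))‖
        ≤ M * ∏ j, ‖v j‖ := by
    intro I _
    rw [ContinuousMultilinearMap.map_smul_univ, norm_smul, mul_comm]
    obtain ⟨α, hα, he⟩ := iteratedFDeriv_word_eq_multiDeriv hf x I
    rw [he, norm_prod]
    gcongr
    · exact h α hα
    · exact PiLp.norm_apply_le _ _
  refine (Finset.sum_le_card_nsmul _ _ _ hb).trans ?_
  rw [nsmul_eq_mul, ← mul_assoc]
  gcongr
  simp only [Finset.card_univ, Fintype.card_fun, Fintype.card_fin, Nat.cast_pow]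
  gcongr
  linarith

/-- Gevrey bounds on partial derivatives and on Fréchet derivatives are equivalent. -/
theorem gevreyNorm_univ_iff {s : ℝ} (hs : 0 ≤ s) {f : EuclideanSpace ℝ ι → ℂ}
    (hf : ContDiff ℝ ∞ f) :
    (∃ h : ℝ, 0 < h ∧ gevreyNorm s h univ f < ⊤) ↔
      ∃ h : ℝ, 0 < h ∧ ∃ C : ℝ, 0 ≤ C ∧ ∀ k x,
        ‖iteratedFDeriv ℝ k f x‖ ≤ C * (h ^ k * (k.factorial : ℝ) ^ s) := by
  constructor
  · rintro ⟨h, hh, hlt⟩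
    obtain ⟨C, hC, hb⟩ := (gevreyNorm_lt_top_iff hh _ _).1 hlt
    refine ⟨(Fintype.card ι + 1 : ℝ) * h, by positivity, C, hC, fun k x => ?_⟩
    refine (norm_iteratedFDeriv_le_of_multiDeriv hf x k (M := C * (h ^ k * (k.factorial : ℝ) ^ s))
      (by positivity) fun α hα => ?_).trans (le_of_eq (by rw [mul_pow]; ring))
    refine (hb α x (mem_univ _)).trans ?_
    rw [hα]
    have := multiFactorial_le α
    rw [hα] at this
    gcongr
  · rintro ⟨h, hh, C, hC, hb⟩
    refine ⟨h * (Fintype.card ι + 1 : ℝ) ^ s, by positivity,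
      (gevreyNorm_lt_top_iff (by positivity) _ _).2 ⟨C, hC, fun α x _ => ?_⟩⟩
    refine (norm_multiDeriv_le α f x).trans ((hb _ x).trans ?_)
    have h1 : ((multiAbs α).factorial : ℝ) ≤ (Fintype.card ι + 1 : ℝ) ^ multiAbs α * multiFactorial α := by
      exact_mod_cast factorial_multiAbs_le α
    have h2 : ((multiAbs α).factorial : ℝ) ^ s ≤
        ((Fintype.card ι + 1 : ℝ) ^ multiAbs α * multiFactorial α) ^ s := by gcongr
    rw [Real.mul_rpow (by positivity) (by positivity), ← Real.rpow_natCast, ← Real.rpow_mul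
      (by positivity), mul_comm _ s, Real.rpow_mul (by positivity), Real.rpow_natCast] at h2
    rw [mul_pow, mul_assoc]
    gcongr

theorem gevreyNorm_univ_mul {s : ℝ} (hs : 0 ≤ s) {f g : EuclideanSpace ℝ ι → ℂ}
    (hf : ContDiff ℝ ∞ f) (hg : ContDiff ℝ ∞ g)
    (hf' : ∃ h : ℝ, 0 < h ∧ gevreyNorm s h univ f < ⊤)
    (hg' : ∃ h : ℝ, 0 < h ∧ gevreyNorm s h univ g < ⊤) :
    ∃ h : ℝ, 0 < h ∧ gevreyNorm s h univ (fun x => f x * g x) < ⊤ := by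
  rw [gevreyNorm_univ_iff hs hf] at hf'
  rw [gevreyNorm_univ_iff hs hg] at hg'
  rw [gevreyNorm_univ_iff hs (hf.mul hg)]
  obtain ⟨a, ha, A, hA, hfb⟩ := hf'
  obtain ⟨b, hb, B, hB, hgb⟩ := hg'
  refine ⟨a + b, by positivity, A * B, by positivity, fun k x => ?_⟩
  refine (norm_iteratedFDeriv_mul_le hf hg x (n := k) (by exact_mod_cast le_top)).trans ?_
  rw [add_pow, Finset.sum_mul, Finset.mul_sum]
  refine Finset.sum_le_sum fun i hi => ?_
  have hik : i ≤ k := Nat.lt_succ_iff.1 (Finset.mem_range.1 hi)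
  have h1 : (i.factorial : ℝ) ^ s * ((k - i).factorial : ℝ) ^ s ≤ (k.factorial : ℝ) ^ s := by
    rw [← Real.mul_rpow (by positivity) (by positivity)]
    gcongr
    exact_mod_cast Nat.le_of_dvd (Nat.factorial_pos _) (Nat.factorial_mul_factorial_dvd_factorial hik)
  calc (k.choose i : ℝ) * ‖iteratedFDeriv ℝ i f x‖ * ‖iteratedFDeriv ℝ (k - i) g x‖
      ≤ (k.choose i : ℝ) * (A * (a ^ i * (i.factorial : ℝ) ^ s)) *
          (B * (b ^ (k - i) * ((k - i).factorial : ℝ) ^ s)) := by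
        gcongr
        · exact hfb i x
        · exact hgb (k - i) x
    _ = A * B * (a ^ i * b ^ (k - i) * k.choose i) * ((i.factorial : ℝ) ^ s * ((k - i).factorial : ℝ) ^ s) := by
        ring
    _ ≤ A * B * (a ^ i * b ^ (k - i) * k.choose i) * (k.factorial : ℝ) ^ s := by gcongr
    _ = _ := by ring

theorem contDiff_exp_inner (ξ : EuclideanSpace ℝ ι) :
    ContDiff ℝ ∞ fun y : EuclideanSpace ℝ ι => Complex.exp (-(Complex.I * (inner ℝ y ξ : ℝ))) := by
  refine Complex.contDiff_exp.comp (ContDiff.neg (contDiff_const.mul ?_))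
  exact Complex.ofRealCLM.contDiff.comp (contDiff_id.inner ℝ contDiff_const)

theorem gevreyNorm_univ_exp_inner {s : ℝ} (hs : 0 ≤ s) (ξ : EuclideanSpace ℝ ι) :
    ∃ h : ℝ, 0 < h ∧ gevreyNorm s h univ
      (fun y : EuclideanSpace ℝ ι => Complex.exp (-(Complex.I * (inner ℝ y ξ : ℝ)))) < ⊤ := by
  rw [gevreyNorm_univ_iff hs (contDiff_exp_inner ξ)]
  have hg : ContDiff ℝ ∞ (fun r : ℝ => Complex.exp (-Complex.I * r)) :=
    Complex.contDiff_exp.comp (contDiff_const.mul Complex.ofRealCLM.contDiff)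
  have hgn : ∀ k (r : ℝ), ‖iteratedFDeriv ℝ k (fun r : ℝ => Complex.exp (-Complex.I * r)) r‖ = 1 := by
    intro k r
    rw [norm_iteratedFDeriv_eq_norm_iteratedDeriv]
    have : ∀ k, iteratedDeriv k (fun r : ℝ => Complex.exp (-Complex.I * r)) =
        fun r : ℝ => (-Complex.I) ^ k * Complex.exp (-Complex.I * r) := by
      intro k
      induction k with
      | zero => simp
      | succ k ih =>
        rw [iteratedDeriv_succ, ih]
        funext r
        have h1 : HasDerivAt (fun r : ℝ => -Complex.I * (r : ℂ)) (-Complex.I) r := by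
          simpa using (Complex.ofRealCLM.hasDerivAt (x := r)).const_mul (-Complex.I)
        rw [(h1.cexp.const_mul _).deriv]
        ring
    rw [this, norm_mul, norm_pow]
    have h2 : -Complex.I * (r : ℂ) = ((-r : ℝ) : ℂ) * Complex.I := by push_cast; ring
    rw [h2, Complex.norm_exp_ofReal_mul_I]
    simp
  refine ⟨‖ξ‖ + 1, by positivity, 1, zero_le_one, fun k x => ?_⟩
  have hcomp : (fun y : EuclideanSpace ℝ ι => Complex.exp (-(Complex.I * (inner ℝ y ξ : ℝ)))) =
      (fun r : ℝ => Complex.exp (-Complex.I * r)) ∘ (innerSL ℝ ξ) := by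
    funext y
    simp [real_inner_comm]
  rw [hcomp, ContinuousLinearMap.iteratedFDeriv_comp_right _ hg x (by exact_mod_cast le_top)]
  refine (ContinuousMultilinearMap.norm_compContinuousLinearMap_le _ _).trans ?_
  rw [hgn, Finset.prod_const, innerSL_apply_norm, Finset.card_univ, Fintype.card_fin]
  have h3 : (1 : ℝ) ≤ (k.factorial : ℝ) ^ s :=
    Real.one_le_rpow (by exact_mod_cast Nat.factorial_pos k) hs
  have h4 : ‖ξ‖ ^ k ≤ (‖ξ‖ + 1) ^ k := by gcongr; linarith
  nlinarith [pow_nonneg (norm_nonneg ξ) k, pow_nonneg (by positivity : (0 : ℝ) ≤ ‖ξ‖ + 1) k]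

theorem multiDeriv_add (α : ι → ℕ) {f g : EuclideanSpace ℝ ι → ℂ}
    (hf : ContDiff ℝ ∞ f) (hg : ContDiff ℝ ∞ g) (x : EuclideanSpace ℝ ι) :
    multiDeriv α (f + g) x = multiDeriv α f x + multiDeriv α g x := by
  unfold multiDeriv
  rw [iteratedFDeriv_add_apply (hf.of_le (by exact_mod_cast le_top)).contDiffAt
    (hg.of_le (by exact_mod_cast le_top)).contDiffAt]
  rfl

theorem multiDeriv_smul (α : ι → ℕ) (c : ℂ) {f : EuclideanSpace ℝ ι → ℂ}
    (hf : ContDiff ℝ ∞ f) (x : EuclideanSpace ℝ ι) :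
    multiDeriv α (c • f) x = c * multiDeriv α f x := by
  unfold multiDeriv
  rw [iteratedFDeriv_const_smul_apply (hf.of_le (by exact_mod_cast le_top)).contDiffAt]
  rfl

end Helpers

/-- The space `G^s_c(Ω)` of compactly supported Gevrey functions of order `s` with support in the
open set `Ω`, realised as functions on the whole of `ℝ^ι` (extended by zero). -/
def GevreyTest {ι : Type*} [Fintype ι] (s : ℝ) (Ω : Set (EuclideanSpace ℝ ι)) :
    Submodule ℂ (EuclideanSpace ℝ ι → ℂ) where
  carrier := {f | ContDiff ℝ ∞ f ∧ HasCompactSupport f ∧ tsupport f ⊆ Ω ∧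
    ∃ h : ℝ, 0 < h ∧ gevreyNorm s h univ f < ⊤}
  zero_mem' := by
    refine ⟨contDiff_const, HasCompactSupport.zero, by simp, 1, one_pos, ?_⟩
    refine (gevreyNorm_lt_top_iff one_pos _ _).2 ⟨0, le_rfl, fun α x _ => ?_⟩
    simp [multiDeriv, iteratedFDeriv_zero]
  add_mem' := by
    rintro f g ⟨hf, hfc, hfs, a, ha, hfa⟩ ⟨hg, hgc, hgs, b, hb, hgb⟩
    obtain ⟨A, hA, hfA⟩ := (gevreyNorm_lt_top_iff ha _ _).1 hfa
    obtain ⟨B, hB, hgB⟩ := (gevreyNorm_lt_top_iff hb _ _).1 hgb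
    refine ⟨hf.add hg, hfc.add hgc, (tsupport_add _ _).trans (union_subset hfs hgs), max a b,
      lt_max_of_lt_left ha, (gevreyNorm_lt_top_iff (lt_max_of_lt_left ha) _ _).2
      ⟨A + B, by positivity, fun α x hx => ?_⟩⟩
    rw [multiDeriv_add α hf hg, add_mul]
    refine (norm_add_le _ _).trans (add_le_add ((hfA α x hx).trans ?_) ((hgB α x hx).trans ?_))
    · gcongr; exact le_max_left _ _
    · gcongr; exact le_max_right _ _
  smul_mem' := by
    rintro c f ⟨hf, hfc, hfs, a, ha, hfa⟩
    obtain ⟨A, hA, hfA⟩ := (gevreyNorm_lt_top_iff ha _ _).1 hfa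
    refine ⟨contDiff_const.smul hf, hfc.smul_left (f := fun _ => c),
      (closure_mono (Function.support_const_smul_subset c f)).trans hfs, a, ha,
      (gevreyNorm_lt_top_iff ha _ _).2 ⟨‖c‖ * A, by positivity, fun α x hx => ?_⟩⟩
    rw [multiDeriv_smul α c hf, norm_mul, mul_assoc]
    gcongr
    exact hfA α x hx

/-- The space `𝒟'_s(Ω)` of ultradistributions of order `s` on the open set `Ω`: linear
functionals on `G^s_c(Ω)` which, for every compact `K ⊆ Ω` and every `h > 0`, are bounded with
respect to `‖·‖_{h,K}` on the test functions supported in `K` for which this norm is finite. -/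
structure Ultradistribution {ι : Type*} [Fintype ι] (s : ℝ) (Ω : Set (EuclideanSpace ℝ ι)) where
  toLinearMap : GevreyTest s Ω →ₗ[ℂ] ℂ
  bounded : ∀ K ⊆ Ω, IsCompact K → ∀ h : ℝ, 0 < h → ∃ C : ℝ≥0, ∀ φ : GevreyTest s Ω,
    tsupport (φ : EuclideanSpace ℝ ι → ℂ) ⊆ K → gevreyNorm s h K φ < ⊤ →
      ‖toLinearMap φ‖ₑ ≤ C * gevreyNorm s h K φ

/-- The test function `y ↦ χ(y) e^{-i y·ξ}`. -/
noncomputable def modulatedTest {ι : Type*} [Fintype ι] {s : ℝ} (hs : 1 < s)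
    {Ω : Set (EuclideanSpace ℝ ι)} (χ : GevreyTest s Ω) (ξ : EuclideanSpace ℝ ι) :
    GevreyTest s Ω :=
  ⟨fun y => (χ : EuclideanSpace ℝ ι → ℂ) y * Complex.exp (-(Complex.I * (inner ℝ y ξ : ℝ))),
    χ.2.1.mul (contDiff_exp_inner ξ), χ.2.2.1.mul_right,
    (tsupport_mul_subset_left (f := (χ : EuclideanSpace ℝ ι → ℂ))).trans χ.2.2.2.1,
    gevreyNorm_univ_mul (by linarith) χ.2.1 (contDiff_exp_inner ξ) χ.2.2.2.2
      (gevreyNorm_univ_exp_inner (by linarith) ξ)⟩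

/-- The Fourier transform `ℱ(χu)(ξ) = (χu)(e^{-i y·ξ}) = u(χ e^{-i y·ξ})` of the compactly
supported ultradistribution `χu`. -/
noncomputable def fourierCutoff {ι : Type*} [Fintype ι] {s : ℝ} (hs : 1 < s)
    {Ω : Set (EuclideanSpace ℝ ι)} (u : Ultradistribution s Ω) (χ : GevreyTest s Ω)
    (ξ : EuclideanSpace ℝ ι) : ℂ :=
  u.toLinearMap (modulatedTest hs χ ξ)

/-- `u` is microlocally `G^s` at `(x₀, ξ₀)`: for some cutoff `χ ∈ G^s_c(Ω)` equal to `1` near `x₀`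
and some open cone `Γ ∋ ξ₀`, one has `|ℱ(χu)(ξ)| ≤ C e^{-ε|ξ|^{1/s}}` on `Γ`. -/
def MicrolocallyGevreyAt {ι : Type*} [Fintype ι] {s : ℝ} (hs : 1 < s)
    {Ω : Set (EuclideanSpace ℝ ι)} (u : Ultradistribution s Ω) (x₀ ξ₀ : EuclideanSpace ℝ ι) :
    Prop :=
  ∃ χ : GevreyTest s Ω, (∀ᶠ y in 𝓝 x₀, (χ : EuclideanSpace ℝ ι → ℂ) y = 1) ∧
    ∃ Γ : Set (EuclideanSpace ℝ ι), IsOpen Γ ∧ ξ₀ ∈ Γ ∧ (∀ r : ℝ, 0 < r → ∀ ξ ∈ Γ, r • ξ ∈ Γ) ∧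
      ∃ C ε : ℝ, 0 < ε ∧ ∀ ξ ∈ Γ,
        ‖fourierCutoff hs u χ ξ‖ ≤ C * Real.exp (-(ε * ‖ξ‖ ^ (1 / s)))

/-- The Gevrey wave-front set `WF_s(u)`, a subset of `Ω × (ℝ^ι ∖ {0})`. -/
def gevreyWaveFrontSet {ι : Type*} [Fintype ι] {s : ℝ} (hs : 1 < s)
    {Ω : Set (EuclideanSpace ℝ ι)} (u : Ultradistribution s Ω) :
    Set (EuclideanSpace ℝ ι × EuclideanSpace ℝ ι) :=
  {p | p.1 ∈ Ω ∧ p.2 ≠ 0 ∧ ¬ MicrolocallyGevreyAt hs u p.1 p.2}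

/-- The point `(x, t) ∈ ℝ^m × ℝ^n = ℝ^{m+n}`. -/
noncomputable def joinPoint {m n : ℕ} (x : EuclideanSpace ℝ (Fin m)) (t : EuclideanSpace ℝ (Fin n)) :
    EuclideanSpace ℝ (Fin m ⊕ Fin n) :=
  WithLp.toLp 2 (Sum.elim x t)

/-- The set `V = B_R^{ℝ^m}(0) × B_R^{ℝ^n}(0)`. -/
def ballProduct (m n : ℕ) (R : ℝ) : Set (EuclideanSpace ℝ (Fin m ⊕ Fin n)) :=
  {p | ∃ x ∈ Metric.ball (0 : EuclideanSpace ℝ (Fin m)) R,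
    ∃ t ∈ Metric.ball (0 : EuclideanSpace ℝ (Fin n)) R, p = joinPoint x t}

/-- The integrand
`ℱ(lam u)(σ,θ) e^{i t·θ} ∫ φ(x) e^{i x·σ} dx` at `ζ = (σ,θ)` of the trace formula. -/
noncomputable def traceIntegrand {m n : ℕ} {s : ℝ} (hs : 1 < s)
    {W : Set (EuclideanSpace ℝ (Fin m ⊕ Fin n))} (u : Ultradistribution s W)
    (lam : GevreyTest s W) (t : EuclideanSpace ℝ (Fin n)) (φ : EuclideanSpace ℝ (Fin m) → ℂ)
    (ζ : EuclideanSpace ℝ (Fin m) × EuclideanSpace ℝ (Fin n)) : ℂ :=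
  fourierCutoff hs u lam (joinPoint ζ.1 ζ.2) * Complex.exp (Complex.I * (inner ℝ t ζ.2 : ℝ)) *
    ∫ x : EuclideanSpace ℝ (Fin m), φ x * Complex.exp (Complex.I * (inner ℝ x ζ.1 : ℝ))

/-- The trace `(ι_t^* u)(φ)`, given by the Fourier integral formula with cutoff `lam`. -/
noncomputable def traceFormula {m n : ℕ} {s : ℝ} (hs : 1 < s)
    {W : Set (EuclideanSpace ℝ (Fin m ⊕ Fin n))} (u : Ultradistribution s W)
    (lam : GevreyTest s W) (t : EuclideanSpace ℝ (Fin n)) (φ : EuclideanSpace ℝ (Fin m) → ℂ) : ℂ :=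
  ((2 * Real.pi : ℂ) ^ (m + n))⁻¹ * ∫ ζ, traceIntegrand hs u lam t φ ζ

/-! Everything rests on one estimate: the integrand of the trace formula is O(A e^{-δ|ζ|^{1/s}})
uniformly in t, where A is a Gevrey constant of φ at a fixed radius
(`exists_norm_traceIntegrand_le`). Two factors compete. Since u is continuous for every Gevrey
radius, ℱ(λu) grows at most like e^{ε|ζ|^{1/s}} for each ε > 0 (`exists_norm_fourierCutoff_le`),
while the x-integral of φ decays like e^{-δ|σ|^{1/s}} (`exists_norm_fourier_le_exp`). Where |σ| ≥
c|θ|, |σ| controls |ζ| and a small ε lets the decay of φ win. Where |σ| < c|θ|, the wave-front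
condition makes ℱ(λu) itself decay (`exists_norm_fourierCutoff_joinPoint_le`).

That conic decay has to be carried from the local cutoffs χ in the definition of the wave-front set
to λ. A factor ψ is expanded in a Fourier series on a large box, which gives ℱ(χψu)(ξ) = Σ c_k
ℱ(χu)(ξ + τ_k) with c_k decaying exponentially (`exists_hasSum_fourierCutoff_mul`); this only
requires applying u term by term. Small shifts τ_k stay in the cone of decay, and large ones are
paid for by c_k. Compactness of supp λ and of the unit sphere in θ does the rest.

Finally, |θ|^k e^{-δ|θ|^{1/s}} ≤ b^k k!^s turns differentiation in t under the integral into Gevrey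
bounds that are linear in A (`contDiff_gevreyBoundAt_traceFormula`). Order zero is the continuity of
the trace in φ; all orders together give the Gevrey regularity and the uniform estimate. -/

/-! ### Exchange between factorial weights k!^s and exponentials of order 1/s. -/

section GevreyWeights

/-- `x^k ≤ b^k k!^s exp (s (x/b)^{1/s})`. -/
theorem pow_le_gevrey_mul_exp {s x b : ℝ} (hs : 0 < s) (hx : 0 ≤ x) (hb : 0 < b) (k : ℕ) :
    x ^ k ≤ Real.exp (s * (x / b) ^ (1 / s)) * (b ^ k * (k.factorial : ℝ) ^ s) := by
  have hy : 0 ≤ x / b := by positivity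
  set y := (x / b) ^ (1 / s) with hydef
  have hy0 : 0 ≤ y := by positivity
  have hfac : (0 : ℝ) < k.factorial := by exact_mod_cast Nat.factorial_pos k
  have h1 : y ^ k ≤ Real.exp y * k.factorial := by
    have := Real.pow_div_factorial_le_exp y hy0 k
    rwa [div_le_iff₀ hfac] at this
  have h2 : (y ^ k) ^ s ≤ (Real.exp y * k.factorial) ^ s := by gcongr
  have h3 : (y ^ k) ^ s = (x / b) ^ k := by
    rw [hydef, ← Real.rpow_natCast, ← Real.rpow_mul hy, ← Real.rpow_mul hy, ← Real.rpow_natCast]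
    congr 1
    field_simp
  rw [h3, Real.mul_rpow (Real.exp_pos _).le hfac.le, ← Real.exp_mul, div_pow,
    div_le_iff₀ (by positivity), mul_comm y s] at h2
  linarith

/-- `x^k exp (-δ x^{1/s}) ≤ b^k k!^s` with `b = (s/δ)^s`. -/
theorem pow_mul_exp_le_gevrey {s x δ : ℝ} (hs : 0 < s) (hx : 0 ≤ x) (hδ : 0 < δ) (k : ℕ) :
    x ^ k * Real.exp (-(δ * x ^ (1 / s))) ≤ ((s / δ) ^ s) ^ k * (k.factorial : ℝ) ^ s := by
  have h := pow_le_gevrey_mul_exp hs hx (b := (s / δ) ^ s) (by positivity) k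
  have h1 : s * (x / (s / δ) ^ s) ^ (1 / s) = δ * x ^ (1 / s) := by
    rw [Real.div_rpow hx (by positivity), ← Real.rpow_mul (by positivity),
      mul_one_div_cancel hs.ne', Real.rpow_one]
    field_simp
  rw [h1] at h
  rw [Real.exp_neg, ← div_eq_mul_inv, div_le_iff₀ (Real.exp_pos _)]
  linarith

/-- Bounds of `x^k F` by `A b^k k!^s` for all `k` give exponential decay of order `1/s`. -/
theorem le_exp_of_forall_pow_mul_le {s x b F A : ℝ} (hs : 0 < s) (hx : 0 ≤ x) (hb : 0 < b)
    (hF : 0 ≤ F) (hA : 0 ≤ A) (h : ∀ k : ℕ, x ^ k * F ≤ A * (b ^ k * (k.factorial : ℝ) ^ s)) :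
    F ≤ 2 ^ s * A * Real.exp (-(s / 2 * (x / b) ^ (1 / s))) := by
  have hy : 0 ≤ x / b := by positivity
  set y := (x / b) ^ (1 / s) with hydef
  have hy0 : 0 ≤ y := by positivity
  have hrt : ∀ z : ℝ, 0 ≤ z → (z ^ (1 / s)) ^ s = z := fun z hz => by
    rw [← Real.rpow_mul hz, one_div_mul_cancel hs.ne', Real.rpow_one]
  -- Instead of optimising in k, take 1/s-th powers and weight by 2^{-k}: summing over k gives
  -- e^{y/2} F^{1/s} ≤ 2 A^{1/s}, whose s-th power is the claim.
  have hk : ∀ k : ℕ, (y / 2) ^ k / k.factorial * F ^ (1 / s) ≤ A ^ (1 / s) * (1 / 2) ^ k := by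
    intro k
    have hfac : (0 : ℝ) < k.factorial := by exact_mod_cast Nat.factorial_pos k
    have h1 : (x / b) ^ k * F ≤ A * (k.factorial : ℝ) ^ s := by
      rw [div_pow, div_mul_eq_mul_div, div_le_iff₀ (by positivity)]
      linarith [h k]
    have h2 : ((x / b) ^ k * F) ^ (1 / s) ≤ (A * (k.factorial : ℝ) ^ s) ^ (1 / s) := by gcongr
    rw [Real.mul_rpow (by positivity) hF, Real.mul_rpow hA (by positivity),
      ← Real.rpow_mul hfac.le, mul_one_div_cancel hs.ne', Real.rpow_one, ← Real.rpow_natCast,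
      ← Real.rpow_mul hy, mul_comm (k : ℝ), Real.rpow_mul hy, Real.rpow_natCast, ← hydef] at h2
    have h3 : (y / 2) ^ k / k.factorial * F ^ (1 / s) =
        (y ^ k * F ^ (1 / s)) * ((1 / 2) ^ k / k.factorial) := by
      rw [div_pow, div_pow]; ring
    rw [h3]
    refine (mul_le_mul_of_nonneg_right h2 (by positivity)).trans (le_of_eq ?_)
    field_simp
  have hsum1 : HasSum (fun k : ℕ => (y / 2) ^ k / k.factorial * F ^ (1 / s))
      (Real.exp (y / 2) * F ^ (1 / s)) := by
    have := NormedSpace.expSeries_div_hasSum_exp (𝔸 := ℝ) (y / 2)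
    rw [← Real.exp_eq_exp_ℝ] at this
    exact this.mul_right _
  have hsum2 : HasSum (fun k : ℕ => A ^ (1 / s) * (1 / 2 : ℝ) ^ k) (A ^ (1 / s) * 2) :=
    hasSum_geometric_two.mul_left _
  have h4 := hasSum_le hk hsum1 hsum2
  have h5 : (Real.exp (y / 2) * F ^ (1 / s)) ^ s ≤ (A ^ (1 / s) * 2) ^ s := by gcongr
  rw [Real.mul_rpow (by positivity) (by positivity), hrt F hF,
    Real.mul_rpow (by positivity) (by positivity), hrt A hA, ← Real.exp_mul] at h5
  rw [Real.exp_neg, ← div_eq_mul_inv, le_div_iff₀ (Real.exp_pos _)]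
  have h6 : y / 2 * s = s / 2 * y := by ring
  rw [h6] at h5
  linarith

end GevreyWeights

/-! ### Pointwise Gevrey bounds on Fréchet derivatives. -/

section GevreyBounds

variable {E : Type*} [NormedAddCommGroup E] [NormedSpace ℝ E]

/-- The Fréchet derivatives of `f` at `x` satisfy `‖D^k f (x)‖ ≤ A a^k k!^s`. -/
def GevreyBoundAt (s A a : ℝ) (f : E → ℂ) (x : E) : Prop :=
  ∀ k : ℕ, ‖iteratedFDeriv ℝ k f x‖ ≤ A * (a ^ k * (k.factorial : ℝ) ^ s)

theorem GevreyBoundAt.mono {s A a A' a' : ℝ} {f : E → ℂ} {x : E} (h : GevreyBoundAt s A a f x)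
    (hA : A ≤ A') (ha : 0 ≤ a) (haa : a ≤ a') (hA' : 0 ≤ A') : GevreyBoundAt s A' a' f x :=
  fun k => (h k).trans (by gcongr)

/-- In the Leibniz formula i!^s (k-i)!^s ≤ k!^s, and the remaining sum is the binomial expansion of
(a + b)^k; hence constants multiply and radii add. -/
theorem GevreyBoundAt.mul {s A a B b : ℝ} {f g : E → ℂ} {x : E} (hs : 0 ≤ s)
    (hA : 0 ≤ A) (ha : 0 ≤ a) (hB : 0 ≤ B) (hb : 0 ≤ b)
    (hf : ContDiff ℝ ∞ f) (hg : ContDiff ℝ ∞ g)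
    (hfb : GevreyBoundAt s A a f x) (hgb : GevreyBoundAt s B b g x) :
    GevreyBoundAt s (A * B) (a + b) (fun y => f y * g y) x := by
  intro k
  refine (norm_iteratedFDeriv_mul_le hf hg x (n := k) (by exact_mod_cast le_top)).trans ?_
  rw [add_pow, Finset.sum_mul, Finset.mul_sum]
  refine Finset.sum_le_sum fun i hi => ?_
  have hik : i ≤ k := Nat.lt_succ_iff.1 (Finset.mem_range.1 hi)
  have h1 : (i.factorial : ℝ) ^ s * ((k - i).factorial : ℝ) ^ s ≤ (k.factorial : ℝ) ^ s := by
    rw [← Real.mul_rpow (by positivity) (by positivity)]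
    gcongr
    exact_mod_cast Nat.le_of_dvd (Nat.factorial_pos _)
      (Nat.factorial_mul_factorial_dvd_factorial hik)
  calc (k.choose i : ℝ) * ‖iteratedFDeriv ℝ i f x‖ * ‖iteratedFDeriv ℝ (k - i) g x‖
      ≤ (k.choose i : ℝ) * (A * (a ^ i * (i.factorial : ℝ) ^ s)) *
          (B * (b ^ (k - i) * ((k - i).factorial : ℝ) ^ s)) := by
        gcongr
        · exact hfb i
        · exact hgb (k - i)
    _ = A * B * (a ^ i * b ^ (k - i) * k.choose i) *
          ((i.factorial : ℝ) ^ s * ((k - i).factorial : ℝ) ^ s) := by ring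
    _ ≤ A * B * (a ^ i * b ^ (k - i) * k.choose i) * (k.factorial : ℝ) ^ s := by gcongr
    _ = _ := by ring

theorem GevreyBoundAt.of_notMem_tsupport {s A a : ℝ} {f : E → ℂ} {x : E} (hA : 0 ≤ A) (ha : 0 ≤ a)
    (hx : x ∉ tsupport f) : GevreyBoundAt s A a f x := by
  intro k
  have : iteratedFDeriv ℝ k f x = 0 := by
    by_contra h
    exact hx (support_iteratedFDeriv_subset (𝕜 := ℝ) k h)
  rw [this, norm_zero]
  positivity

end GevreyBounds

/-! ### Plane waves. -/

section Exponentials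

variable {ι : Type*} [Fintype ι]

/-- The plane wave `y ↦ e^{-i⟨y,ξ⟩}`. -/
noncomputable def planeWave (ξ : EuclideanSpace ℝ ι) (y : EuclideanSpace ℝ ι) : ℂ :=
  Complex.exp (-(Complex.I * (inner ℝ y ξ : ℝ)))

theorem contDiff_planeWave (ξ : EuclideanSpace ℝ ι) : ContDiff ℝ ∞ (planeWave ξ) :=
  contDiff_exp_inner ξ

theorem planeWave_add (ξ η y : EuclideanSpace ℝ ι) :
    planeWave (ξ + η) y = planeWave ξ y * planeWave η y := by
  simp only [planeWave]
  rw [← Complex.exp_add, inner_add_right]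
  congr 1
  push_cast
  ring

theorem norm_iteratedFDeriv_planeWave_le (ξ y : EuclideanSpace ℝ ι) (k : ℕ) :
    ‖iteratedFDeriv ℝ k (planeWave ξ) y‖ ≤ ‖ξ‖ ^ k := by
  have hg : ContDiff ℝ ∞ (fun r : ℝ => Complex.exp (-Complex.I * r)) :=
    Complex.contDiff_exp.comp (contDiff_const.mul Complex.ofRealCLM.contDiff)
  have hgn : ∀ k (r : ℝ),
      ‖iteratedFDeriv ℝ k (fun r : ℝ => Complex.exp (-Complex.I * r)) r‖ = 1 := by
    intro k r
    rw [norm_iteratedFDeriv_eq_norm_iteratedDeriv]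
    have : ∀ k, iteratedDeriv k (fun r : ℝ => Complex.exp (-Complex.I * r)) =
        fun r : ℝ => (-Complex.I) ^ k * Complex.exp (-Complex.I * r) := by
      intro k
      induction k with
      | zero => simp
      | succ k ih =>
        rw [iteratedDeriv_succ, ih]
        funext r
        have h1 : HasDerivAt (fun r : ℝ => -Complex.I * (r : ℂ)) (-Complex.I) r := by
          simpa using (Complex.ofRealCLM.hasDerivAt (x := r)).const_mul (-Complex.I)
        rw [(h1.cexp.const_mul _).deriv]
        ring
    rw [this, norm_mul, norm_pow]
    have h2 : -Complex.I * (r : ℂ) = ((-r : ℝ) : ℂ) * Complex.I := by push_cast; ring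
    rw [h2, Complex.norm_exp_ofReal_mul_I]
    simp
  have hcomp : planeWave ξ = (fun r : ℝ => Complex.exp (-Complex.I * r)) ∘ (innerSL ℝ ξ) := by
    funext y
    simp [planeWave, real_inner_comm]
  rw [hcomp, ContinuousLinearMap.iteratedFDeriv_comp_right _ hg y (by exact_mod_cast le_top)]
  refine (ContinuousMultilinearMap.norm_compContinuousLinearMap_le _ _).trans ?_
  rw [hgn, Finset.prod_const, innerSL_apply_norm, Finset.card_univ, Fintype.card_fin, one_mul]

/-- The frequency enters only through the constant, while the radius b is free: a larger b buys
slower growth in ξ. -/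
theorem gevreyBoundAt_planeWave {s b : ℝ} (hs : 0 < s) (hb : 0 < b) (ξ y : EuclideanSpace ℝ ι) :
    GevreyBoundAt s (Real.exp (s * (‖ξ‖ / b) ^ (1 / s))) b (planeWave ξ) y := fun k =>
  (norm_iteratedFDeriv_planeWave_le ξ y k).trans
    (pow_le_gevrey_mul_exp hs (norm_nonneg ξ) hb k)

/-- The point is the factor ‖η‖ at a fixed radius, which yields continuity of the Fourier transform
in the frequency. Order zero uses |e^{ir} - 1| ≤ |r|; higher orders use ‖η‖^{k+1} ≤ ‖η‖. -/
theorem gevreyBoundAt_planeWave_sub_one {s : ℝ} (hs : 0 ≤ s) {η y : EuclideanSpace ℝ ι}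
    (hη : ‖η‖ ≤ 1) :
    GevreyBoundAt s ((‖y‖ + 1) * ‖η‖) 1 (fun z => planeWave η z - 1) y := by
  intro k
  rw [one_pow, one_mul]
  have h3 : (1 : ℝ) ≤ (k.factorial : ℝ) ^ s :=
    Real.one_le_rpow (by exact_mod_cast Nat.factorial_pos k) hs
  have key : ‖iteratedFDeriv ℝ k (fun z => planeWave η z - 1) y‖ ≤ (‖y‖ + 1) * ‖η‖ := by
    rcases k with _ | k
    · rw [norm_iteratedFDeriv_zero]
      have h4 : planeWave η y = Complex.exp (Complex.I * (-(inner ℝ y η : ℝ) : ℝ)) := by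
        simp [planeWave]
      rw [h4]
      refine (Real.norm_exp_I_mul_ofReal_sub_one_le).trans ?_
      rw [norm_neg]
      refine (norm_inner_le_norm y η).trans ?_
      gcongr
      linarith
    · have h5 : iteratedFDeriv ℝ (k + 1) (fun z => planeWave η z - 1) y =
          iteratedFDeriv ℝ (k + 1) (planeWave η) y := by
        have := iteratedFDeriv_sub_apply (𝕜 := ℝ) (i := k + 1) (x := y)
          (((contDiff_planeWave η).of_le (by exact_mod_cast le_top)).contDiffAt)
          ((contDiff_const (c := (1 : ℂ))).contDiffAt)
        rw [iteratedFDeriv_const_of_ne (by omega)] at this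
        simpa using! this
      rw [h5]
      refine (norm_iteratedFDeriv_planeWave_le η y _).trans ?_
      rw [pow_succ]
      gcongr
      exact (pow_le_one₀ (norm_nonneg _) hη).trans (by linarith [norm_nonneg y])
  exact key.trans (le_mul_of_one_le_right (by positivity) h3)

end Exponentials

/-! ### Continuity of ultradistributions and the Fourier transform of χu. -/

section Ultradistributions

variable {ι : Type*} [Fintype ι] {s : ℝ} {Ω : Set (EuclideanSpace ℝ ι)}

/-- The loss in the radius comes from |α|! ≤ (card ι + 1)^{|α|} α!, raised to the power s. -/
theorem gevreyNorm_le_of_gevreyBoundAt (hs : 0 ≤ s) {A h : ℝ} (hA : 0 ≤ A) (hh : 0 < h)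
    {K : Set (EuclideanSpace ℝ ι)} {f : EuclideanSpace ℝ ι → ℂ}
    (hf : ∀ x ∈ K, GevreyBoundAt s A h f x) :
    gevreyNorm s (h * (Fintype.card ι + 1 : ℝ) ^ s) K f ≤ ENNReal.ofReal A := by
  refine iSup_le fun α => ?_
  have hpos : 0 < multiFactorial α := Finset.prod_pos fun i _ => Nat.factorial_pos _
  have hw : 0 < (h * (Fintype.card ι + 1 : ℝ) ^ s) ^ multiAbs α * (multiFactorial α : ℝ) ^ s := by
    positivity
  rw [ENNReal.div_le_iff (by simpa using hw) ENNReal.ofReal_ne_top, ← ENNReal.ofReal_mul hA]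
  refine iSup₂_le fun x hx => ?_
  rw [← ofReal_norm]
  refine ENNReal.ofReal_le_ofReal ?_
  refine (norm_multiDeriv_le α f x).trans ((hf x hx _).trans ?_)
  have h1 : ((multiAbs α).factorial : ℝ) ≤
      (Fintype.card ι + 1 : ℝ) ^ multiAbs α * multiFactorial α := by
    exact_mod_cast factorial_multiAbs_le α
  have h2 : ((multiAbs α).factorial : ℝ) ^ s ≤
      ((Fintype.card ι + 1 : ℝ) ^ multiAbs α * multiFactorial α) ^ s := by gcongr
  rw [Real.mul_rpow (by positivity) (by positivity), ← Real.rpow_natCast, ← Real.rpow_mul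
    (by positivity), mul_comm _ s, Real.rpow_mul (by positivity), Real.rpow_natCast] at h2
  rw [mul_pow, mul_assoc]
  gcongr

/-- Continuity in the form used below. The change of radius is harmless because `bounded` is
available at every radius. -/
theorem Ultradistribution.exists_norm_le_of_gevreyBoundAt (hs : 0 ≤ s) (u : Ultradistribution s Ω)
    {K : Set (EuclideanSpace ℝ ι)} (hK : IsCompact K) (hKΩ : K ⊆ Ω) {h : ℝ} (hh : 0 < h) :
    ∃ C : ℝ, 0 ≤ C ∧ ∀ φ : GevreyTest s Ω, tsupport (φ : EuclideanSpace ℝ ι → ℂ) ⊆ K →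
      ∀ A : ℝ, 0 ≤ A → (∀ x ∈ K, GevreyBoundAt s A h φ x) → ‖u.toLinearMap φ‖ ≤ C * A := by
  obtain ⟨C, hC⟩ := u.bounded K hKΩ hK (h * (Fintype.card ι + 1 : ℝ) ^ s) (by positivity)
  refine ⟨C, C.2, fun φ hφ A hA hb => ?_⟩
  have h1 := gevreyNorm_le_of_gevreyBoundAt hs hA hh hb
  have h2 := (hC φ hφ (h1.trans_lt ENNReal.ofReal_lt_top)).trans (mul_le_mul_right h1 _)
  rw [← ofReal_norm, ← ENNReal.ofReal_coe_nnreal, ← ENNReal.ofReal_mul C.coe_nonneg] at h2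
  exact (ENNReal.ofReal_le_ofReal_iff (by positivity)).1 h2

theorem GevreyTest.exists_gevreyBoundAt (hs : 0 ≤ s) (χ : GevreyTest s Ω) :
    ∃ A a : ℝ, 0 ≤ A ∧ 0 < a ∧ ∀ x, GevreyBoundAt s A a (χ : EuclideanSpace ℝ ι → ℂ) x := by
  obtain ⟨h, hh, C, hC, hb⟩ := (gevreyNorm_univ_iff hs χ.2.1).1 χ.2.2.2.2
  exact ⟨C, h, hC, hh, fun x k => hb k x⟩

/-- The product of two test functions. -/
def GevreyTest.mul (hs : 0 ≤ s) (χ ψ : GevreyTest s Ω) : GevreyTest s Ω :=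
  ⟨fun y => (χ : EuclideanSpace ℝ ι → ℂ) y * (ψ : EuclideanSpace ℝ ι → ℂ) y,
    χ.2.1.mul ψ.2.1, χ.2.2.1.mul_right,
    (tsupport_mul_subset_left (f := (χ : EuclideanSpace ℝ ι → ℂ))).trans χ.2.2.2.1,
    gevreyNorm_univ_mul hs χ.2.1 ψ.2.1 χ.2.2.2.2 ψ.2.2.2.2⟩

theorem modulatedTest_apply (hs : 1 < s) (χ : GevreyTest s Ω) (ξ y : EuclideanSpace ℝ ι) :
    (modulatedTest hs χ ξ : EuclideanSpace ℝ ι → ℂ) y =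
      (χ : EuclideanSpace ℝ ι → ℂ) y * planeWave ξ y := rfl

theorem tsupport_modulatedTest_subset (hs : 1 < s) (χ : GevreyTest s Ω) (ξ : EuclideanSpace ℝ ι) :
    tsupport (modulatedTest hs χ ξ : EuclideanSpace ℝ ι → ℂ) ⊆
      tsupport (χ : EuclideanSpace ℝ ι → ℂ) :=
  tsupport_mul_subset_left (f := (χ : EuclideanSpace ℝ ι → ℂ))

/-- For each `ε > 0`, the modulated test functions `χ e^{-i⟨·,ξ⟩}` satisfy Gevrey bounds with a
common radius and a constant growing at most like `e^{ε|ξ|^{1/s}}`. -/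
theorem exists_gevreyBoundAt_modulatedTest (hs : 1 < s) (χ : GevreyTest s Ω) {ε : ℝ} (hε : 0 < ε) :
    ∃ A a : ℝ, 0 ≤ A ∧ 0 < a ∧ ∀ ξ x, GevreyBoundAt s (A * Real.exp (ε * ‖ξ‖ ^ (1 / s))) a
      (modulatedTest hs χ ξ : EuclideanSpace ℝ ι → ℂ) x := by
  have hs0 : 0 < s := by linarith
  obtain ⟨A, a, hA, ha, hb⟩ := GevreyTest.exists_gevreyBoundAt hs0.le χ
  -- The plane wave is given the radius (s/ε)^s, for which its constant is exactly e^{ε|ξ|^{1/s}}.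
  refine ⟨A, a + (s / ε) ^ s, hA, by positivity, fun ξ x => ?_⟩
  have h1 := gevreyBoundAt_planeWave (s := s) (b := (s / ε) ^ s) hs0 (by positivity) ξ x
  have h2 : s * (‖ξ‖ / (s / ε) ^ s) ^ (1 / s) = ε * ‖ξ‖ ^ (1 / s) := by
    rw [Real.div_rpow (norm_nonneg _) (by positivity), ← Real.rpow_mul (by positivity),
      mul_one_div_cancel hs0.ne', Real.rpow_one]
    field_simp
  rw [h2] at h1
  exact (hb x).mul hs0.le hA ha.le (by positivity) (by positivity) χ.2.1 (contDiff_planeWave ξ) h1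

/-- Subexponential growth of the Fourier transform of a compactly supported ultradistribution. -/
theorem exists_norm_fourierCutoff_le (hs : 1 < s) (u : Ultradistribution s Ω) (χ : GevreyTest s Ω)
    {ε : ℝ} (hε : 0 < ε) :
    ∃ C : ℝ, 0 ≤ C ∧ ∀ ξ, ‖fourierCutoff hs u χ ξ‖ ≤ C * Real.exp (ε * ‖ξ‖ ^ (1 / s)) := by
  obtain ⟨A, a, hA, ha, hb⟩ := exists_gevreyBoundAt_modulatedTest hs χ hε
  obtain ⟨C, hC, hu⟩ := u.exists_norm_le_of_gevreyBoundAt (by linarith) χ.2.2.1.isCompact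
    χ.2.2.2.1 ha
  refine ⟨C * A, by positivity, fun ξ => ?_⟩
  rw [mul_assoc]
  exact hu _ (tsupport_modulatedTest_subset hs χ ξ) _ (by positivity) fun x _ => hb ξ x

/-- The difference of the test functions at ξ' and ξ is χ e^{-i⟨·,ξ⟩}(e^{-i⟨·,ξ'-ξ⟩} - 1), whose
Gevrey constant on supp χ is O(|ξ' - ξ|) at a radius independent of ξ'. -/
theorem continuous_fourierCutoff (hs : 1 < s) (u : Ultradistribution s Ω) (χ : GevreyTest s Ω) :
    Continuous (fourierCutoff hs u χ) := by
  have hs0 : 0 ≤ s := by linarith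
  rw [continuous_iff_continuousAt]
  intro ξ
  obtain ⟨A, a, hA, ha, hb⟩ := GevreyTest.exists_gevreyBoundAt hs0 (modulatedTest hs χ ξ)
  have hK : IsCompact (tsupport (χ : EuclideanSpace ℝ ι → ℂ)) := χ.2.2.1.isCompact
  obtain ⟨r, hr⟩ := hK.isBounded.exists_norm_le
  obtain ⟨C, hC, hu⟩ := u.exists_norm_le_of_gevreyBoundAt hs0 hK χ.2.2.2.1
    (h := a + 1) (by positivity)
  have key : ∀ ξ' : EuclideanSpace ℝ ι, ‖ξ' - ξ‖ ≤ 1 →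
      ‖fourierCutoff hs u χ ξ' - fourierCutoff hs u χ ξ‖ ≤ C * (A * ((|r| + 1) * ‖ξ' - ξ‖)) := by
    intro ξ' h1
    have hdiff : ((modulatedTest hs χ ξ' - modulatedTest hs χ ξ : GevreyTest s Ω) :
        EuclideanSpace ℝ ι → ℂ) =
        fun y => (modulatedTest hs χ ξ : EuclideanSpace ℝ ι → ℂ) y *
          (planeWave (ξ' - ξ) y - 1) := by
      funext y
      have h2 : planeWave ξ' y = planeWave ξ y * planeWave (ξ' - ξ) y := by
        rw [← planeWave_add, add_sub_cancel]
      simp only [Submodule.coe_sub, Pi.sub_apply, modulatedTest_apply, h2]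
      ring
    unfold fourierCutoff
    rw [← map_sub]
    refine hu _ ?_ _ (by positivity) fun x hx => ?_
    · rw [hdiff]
      exact (tsupport_mul_subset_left (f := (modulatedTest hs χ ξ : EuclideanSpace ℝ ι → ℂ))).trans
        (tsupport_modulatedTest_subset hs χ ξ)
    · rw [hdiff]
      refine (hb x).mul hs0 hA ha.le (by positivity) zero_le_one (modulatedTest hs χ ξ).2.1
        ((contDiff_planeWave _).sub contDiff_const) ?_
      refine (gevreyBoundAt_planeWave_sub_one hs0 h1).mono ?_ zero_le_one le_rfl (by positivity)
      gcongr
      exact (hr x hx).trans (le_abs_self r)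
  rw [ContinuousAt, tendsto_iff_norm_sub_tendsto_zero]
  have hlim : Filter.Tendsto (fun ξ' => C * (A * ((|r| + 1) * ‖ξ' - ξ‖))) (𝓝 ξ) (𝓝 0) := by
    have : Continuous fun ξ' : EuclideanSpace ℝ ι => C * (A * ((|r| + 1) * ‖ξ' - ξ‖)) := by fun_prop
    simpa using this.tendsto ξ
  refine squeeze_zero' (Filter.Eventually.of_forall fun _ => norm_nonneg _) ?_ hlim
  filter_upwards [Metric.closedBall_mem_nhds ξ one_pos] with ξ' h
  exact key ξ' (by simpa [dist_eq_norm] using h)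

/-- An ultradistribution may be applied term by term to a series of test functions with summable
Gevrey bounds. -/
theorem Ultradistribution.hasSum_of_gevreyBoundAt (hs : 0 ≤ s) (u : Ultradistribution s Ω)
    {κ : Type*} {K : Set (EuclideanSpace ℝ ι)} (hK : IsCompact K) (hKΩ : K ⊆ Ω) {h : ℝ} (hh : 0 < h)
    {f : κ → GevreyTest s Ω} {g : GevreyTest s Ω} {a : κ → ℝ} (ha0 : ∀ k, 0 ≤ a k)
    (ha : Summable a) (hfK : ∀ k, tsupport (f k : EuclideanSpace ℝ ι → ℂ) ⊆ K)
    (hgK : tsupport (g : EuclideanSpace ℝ ι → ℂ) ⊆ K)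
    (hfb : ∀ k x, GevreyBoundAt s (a k) h (f k : EuclideanSpace ℝ ι → ℂ) x)
    (hg : ∀ y, (g : EuclideanSpace ℝ ι → ℂ) y = ∑' k, (f k : EuclideanSpace ℝ ι → ℂ) y) :
    HasSum (fun k => u.toLinearMap (f k)) (u.toLinearMap g) := by
  classical
  obtain ⟨C, hC, hu⟩ := u.exists_norm_le_of_gevreyBoundAt hs hK hKΩ hh
  have hsumk : ∀ j : ℕ, Summable fun k => a k * (h ^ j * (j.factorial : ℝ) ^ s) :=
    fun j => ha.mul_right _
  -- Termwise differentiation of the tail: the remainder after S then has Gevrey constant Σ_{k ∉ S}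
  -- a k, which tends to 0.
  have hderiv : ∀ (S : Finset κ) (j : ℕ) (x : EuclideanSpace ℝ ι),
      iteratedFDeriv ℝ j ((g - ∑ k ∈ S, f k : GevreyTest s Ω) : EuclideanSpace ℝ ι → ℂ) x =
        ∑' k : {k // k ∉ S}, iteratedFDeriv ℝ j (f k : EuclideanSpace ℝ ι → ℂ) x := by
    intro S j x
    have h1 : ((g - ∑ k ∈ S, f k : GevreyTest s Ω) : EuclideanSpace ℝ ι → ℂ) =
        fun y => ∑' k : {k // k ∉ S}, (f k : EuclideanSpace ℝ ι → ℂ) y := by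
      funext y
      have hs1 : Summable fun k => (f k : EuclideanSpace ℝ ι → ℂ) y := by
        refine Summable.of_norm_bounded (hsumk 0) fun k => ?_
        have := hfb k y 0
        rwa [norm_iteratedFDeriv_zero] at this
      have h2 := hs1.sum_add_tsum_subtype_compl S
      rw [Submodule.coe_sub, Pi.sub_apply, hg y, ← h2, AddSubmonoidClass.coe_finsetSum,
        Finset.sum_apply]
      simp
    rw [h1]
    exact iteratedFDeriv_tsum_apply (N := ⊤) (v := fun j (k : {k // k ∉ S}) =>
        a k * (h ^ j * (j.factorial : ℝ) ^ s)) (fun k => (f k).2.1)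
      (fun j _ => (hsumk j).subtype _) (fun j k x _ => hfb k x j) le_top x
  rw [HasSum, tendsto_iff_norm_sub_tendsto_zero]
  have hlim : Filter.Tendsto (fun S : Finset κ => C * ∑' k : {k // k ∉ S}, a k)
      Filter.atTop (𝓝 0) := by
    simpa using (tendsto_tsum_compl_atTop_zero a).const_mul C
  refine squeeze_zero (fun _ => norm_nonneg _) (fun S => ?_) hlim
  rw [norm_sub_rev, ← map_sum, ← map_sub]
  refine hu _ ?_ _ (tsum_nonneg fun k => ha0 _) fun x _ j => ?_
  · refine closure_minimal (fun y hy => ?_) hK.isClosed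
    by_contra hyK
    refine hy ?_
    have hz : ∀ k, (f k : EuclideanSpace ℝ ι → ℂ) y = 0 :=
      fun k => image_eq_zero_of_notMem_tsupport fun h => hyK (hfK k h)
    rw [Submodule.coe_sub, Pi.sub_apply, image_eq_zero_of_notMem_tsupport fun h => hyK (hgK h),
      AddSubmonoidClass.coe_finsetSum, Finset.sum_apply, Finset.sum_eq_zero fun k _ => hz k, sub_zero]
  · rw [hderiv, ← tsum_mul_right]
    exact tsum_of_norm_bounded ((hsumk j).subtype _).hasSum fun k => hfb k x j

end Ultradistributions

/-! ### Decay of Fourier transforms of Gevrey test functions. -/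

section FourierDecay

open scoped FourierTransform

variable {ι : Type*} [Fintype ι]

/-- The Fourier transform of a compactly supported Gevrey function of order `s` decays like
`e^{-δ|w|^{1/s}}`, uniformly over functions with common support and radius. -/
theorem exists_norm_fourier_le_exp {s : ℝ} (hs : 0 < s) {B : Set (EuclideanSpace ℝ ι)}
    (hB : Bornology.IsBounded B) {a : ℝ} (ha : 0 < a) :
    ∃ C δ : ℝ, 0 ≤ C ∧ 0 < δ ∧ ∀ φ : EuclideanSpace ℝ ι → ℂ, ContDiff ℝ ∞ φ →
      HasCompactSupport φ → tsupport φ ⊆ B → ∀ A : ℝ, 0 ≤ A → (∀ x, GevreyBoundAt s A a φ x) →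
        ∀ w, ‖𝓕 φ w‖ ≤ C * A * Real.exp (-(δ * ‖w‖ ^ (1 / s))) := by
  obtain ⟨r, hr⟩ := hB.subset_closedBall 0
  set V := (volume : Measure (EuclideanSpace ℝ ι)).real (Metric.closedBall 0 r) with hV
  have hV0 : 0 ≤ V := measureReal_nonneg
  refine ⟨2 ^ s * V, s / 2 * (1 / (4 * (a + 1))) ^ (1 / s), by positivity, by positivity,
    fun φ hφ hφc hφB A hA hb w => ?_⟩
  have hint : ∀ j : ℕ, Integrable (iteratedFDeriv ℝ j φ) := fun j =>
    (hφ.continuous_iteratedFDeriv (by exact_mod_cast le_top)).integrable_of_hasCompactSupport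
      (hφc.iteratedFDeriv j)
  have hI : ∀ j : ℕ, ∫ v, ‖iteratedFDeriv ℝ j φ v‖ ≤ V * (A * (a ^ j * (j.factorial : ℝ) ^ s)) := by
    intro j
    have h1 : ∫ v, ‖iteratedFDeriv ℝ j φ v‖ =
        ∫ v in Metric.closedBall 0 r, ‖iteratedFDeriv ℝ j φ v‖ := by
      refine (setIntegral_eq_integral_of_forall_compl_eq_zero fun x hx => ?_).symm
      rw [norm_eq_zero]
      by_contra h
      exact hx (hr (hφB (support_iteratedFDeriv_subset (𝕜 := ℝ) j h)))
    rw [h1]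
    refine (le_abs_self _).trans ?_
    rw [← Real.norm_eq_abs, mul_comm V]
    refine norm_setIntegral_le_of_norm_le_const measure_closedBall_lt_top fun x _ => ?_
    rw [norm_norm]
    exact hb x j
  -- The 4 is 2 · 2: one 2^k comes from the general inequality for ‖w‖^k ‖𝓕 φ w‖, the other from the
  -- k + 1 terms of its sum. Using a + 1 ≥ 1 lets every order j ≤ k be bounded by order k.
  have key : ∀ k : ℕ, ‖w‖ ^ k * ‖𝓕 φ w‖ ≤
      V * A * ((4 * (a + 1)) ^ k * (k.factorial : ℝ) ^ s) := by
    intro k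
    have h0 := Real.pow_mul_norm_iteratedFDeriv_fourier_le (K := 0) (N := ⊤) (f := φ) hφ
      (fun k' n hk' _ => by
        obtain rfl : k' = 0 := by simpa using hk'
        simpa using (hint n).norm) (k := 0) (n := k) le_rfl le_top w
    rw [norm_iteratedFDeriv_zero] at h0
    refine h0.trans ?_
    have hterm : ∀ p ∈ Finset.range (0 + 1) ×ˢ Finset.range (k + 1),
        ∫ v, ‖v‖ ^ p.1 * ‖iteratedFDeriv ℝ p.2 φ v‖ ≤
          V * A * ((a + 1) ^ k * (k.factorial : ℝ) ^ s) := by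
      rintro ⟨i, j⟩ hp
      simp only [Finset.mem_product, Finset.mem_range] at hp
      obtain rfl : i = 0 := by omega
      have hjk : j ≤ k := by omega
      simp only [pow_zero, one_mul]
      refine (hI j).trans ?_
      rw [← mul_assoc]
      gcongr
      calc a ^ j ≤ (a + 1) ^ j := by gcongr; linarith
        _ ≤ (a + 1) ^ k := pow_le_pow_right₀ (by linarith) hjk
    refine (mul_le_mul_of_nonneg_left (Finset.sum_le_card_nsmul _ _ _ hterm)
      (by positivity)).trans ?_
    have h2 : ((k : ℝ) + 1) ≤ 2 ^ k := by exact_mod_cast Nat.lt_two_pow_self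
    simp only [Finset.card_product, Finset.card_range, nsmul_eq_mul, pow_zero, one_mul, zero_add,
      CharP.cast_eq_zero, mul_zero, Nat.cast_add, Nat.cast_one]
    calc (2 : ℝ) ^ k * (((k : ℝ) + 1) * (V * A * ((a + 1) ^ k * (k.factorial : ℝ) ^ s)))
        ≤ 2 ^ k * (2 ^ k * (V * A * ((a + 1) ^ k * (k.factorial : ℝ) ^ s))) := by gcongr
      _ = V * A * ((4 * (a + 1)) ^ k * (k.factorial : ℝ) ^ s) := by
        rw [show (4 : ℝ) * (a + 1) = 2 * 2 * (a + 1) by ring, mul_pow, mul_pow]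
        ring
  have h3 := le_exp_of_forall_pow_mul_le hs (norm_nonneg w) (by positivity) (norm_nonneg _)
    (by positivity) key
  refine h3.trans (le_of_eq ?_)
  rw [div_eq_mul_one_div ‖w‖, Real.mul_rpow (norm_nonneg _) (by positivity), ← mul_assoc (2 ^ s),
    mul_comm (‖w‖ ^ (1 / s)), ← mul_assoc]

end FourierDecay

/-! ### Fourier series on a box of side L. -/

section FourierSeries

open scoped FourierTransform

variable {ι : Type*} [Fintype ι]

/-- The frequency `k / L`, for `k ∈ ℤ^ι`. -/
noncomputable def latticePoint (L : ℝ) (k : ι → ℤ) : EuclideanSpace ℝ ι :=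
  WithLp.toLp 2 fun i => (k i : ℝ) / L

/-- The function on the torus which is `x ↦ ψ (L x)` on the box `[-1/2, 1/2)^ι`. -/
noncomputable def torusLift (L : ℝ) (ψ : EuclideanSpace ℝ ι → ℂ) (x : UnitAddTorus ι) : ℂ :=
  ψ (WithLp.toLp 2 fun i => L * (AddCircle.equivIco (1 : ℝ) (-1 / 2) (x i) : ℝ))

theorem norm_eq_abs_equivIco (z : UnitAddCircle) :
    ‖z‖ = |(AddCircle.equivIco (1 : ℝ) (-1 / 2) z : ℝ)| := by
  have h1 := (AddCircle.equivIco (1 : ℝ) (-1 / 2) z).2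
  have h2 : |(AddCircle.equivIco (1 : ℝ) (-1 / 2) z : ℝ)| ≤ |(1 : ℝ)| / 2 := by
    rw [abs_one, abs_le]
    constructor <;> linarith [h1.1, h1.2]
  have h3 := (AddCircle.norm_coe_eq_abs_iff (1 : ℝ) one_ne_zero).2 h2
  rwa [AddCircle.coe_equivIco] at h3

variable {L : ℝ} {ψ : EuclideanSpace ℝ ι → ℂ}

theorem torusLift_eq_zero {κ : Type*} {ψ : EuclideanSpace ℝ κ → ℂ} (hL : 0 < L)
    (hsupp : ∀ y, ψ y ≠ 0 → ∀ i, |y i| ≤ L / 4) {x : UnitAddTorus κ} {i : κ} (hx : 1 / 4 < ‖x i‖) : torusLift L ψ x = 0 := by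
  by_contra h
  have h1 := hsupp _ h i
  simp only [abs_mul, abs_of_pos hL] at h1
  rw [norm_eq_abs_equivIco] at hx
  nlinarith

/-- The representative in [-1/2, 1/2) jumps only at the class of -1/2, and near that class the lift
vanishes, because ψ lives in the inner half of the box. -/
theorem continuous_torusLift (hL : 0 < L) (hψ : Continuous ψ)
    (hsupp : ∀ y, ψ y ≠ 0 → ∀ i, |y i| ≤ L / 4) : Continuous (torusLift L ψ) := by
  rw [continuous_iff_continuousAt]
  intro x
  by_cases hx : ∃ i, 1 / 4 < ‖x i‖
  · obtain ⟨i, hi⟩ := hx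
    have hev : ∀ᶠ z : UnitAddTorus ι in 𝓝 x, torusLift L ψ z = 0 := by
      have hcont : Continuous fun z : UnitAddTorus ι => ‖z i‖ := (continuous_apply i).norm
      filter_upwards [hcont.tendsto x (lt_mem_nhds hi)] with z hz
      exact torusLift_eq_zero hL hsupp hz
    exact continuousAt_const.congr (hev.mono fun z hz => hz.symm)
  · push Not at hx
    refine hψ.continuousAt.comp ?_
    refine (PiLp.continuous_toLp 2 _).continuousAt.comp ?_
    refine continuousAt_pi.2 fun i => continuousAt_const.mul ?_
    have hne : x i ≠ ((-1 / 2 : ℝ) : UnitAddCircle) := by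
      intro h
      have h1 := hx i
      have h2 : ‖((-1 / 2 : ℝ) : UnitAddCircle)‖ = |(-1 / 2 : ℝ)| :=
        (AddCircle.norm_coe_eq_abs_iff (1 : ℝ) one_ne_zero).2 (by norm_num [abs_of_neg])
      rw [h, h2] at h1
      norm_num [abs_of_neg] at h1
    have h3 : ContinuousAt (fun z : UnitAddTorus ι => z i) x := (continuous_apply i).continuousAt
    exact continuousAt_subtype_val.comp
      (ContinuousAt.comp (f := fun z : UnitAddTorus ι => z i)
        (AddCircle.continuousAt_equivIco (1 : ℝ) (-1 / 2) hne) h3)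

/-- The endpoint 1/2, whose representative is -1/2, is allowed since both sides vanish there. This
reconciles the half-open interval `Ico` of the lift with the `Ioc` of the coefficient integral. -/
theorem torusLift_coe (hL : 0 < L) (hsupp : ∀ y, ψ y ≠ 0 → ∀ i, |y i| ≤ L / 4) {x : ι → ℝ}
    (hx : ∀ i, |x i| ≤ 1 / 2) :
    torusLift L ψ (fun i => (x i : UnitAddCircle)) = ψ (L • WithLp.toLp 2 x) := by
  by_cases h : ∃ i, 1 / 4 < |x i|
  · obtain ⟨i, hi⟩ := h
    rw [torusLift_eq_zero hL hsupp (i := i)]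
    · by_contra h0
      have h1 := hsupp _ (Ne.symm h0) i
      simp only [PiLp.smul_apply, smul_eq_mul, abs_mul, abs_of_pos hL] at h1
      nlinarith
    · rwa [(AddCircle.norm_coe_eq_abs_iff (1 : ℝ) one_ne_zero).2 (by simpa using hx i)]
  · push Not at h
    unfold torusLift
    congr 1
    ext i
    have hm : x i ∈ Ico (-1 / 2 : ℝ) (-1 / 2 + 1) := by
      have := abs_le.1 (h i)
      constructor <;> linarith [this.1, this.2]
    simp [AddCircle.equivIco_coe_of_mem hm]

theorem mFourier_coe (k : ι → ℤ) (x : ι → ℝ) :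
    UnitAddTorus.mFourier k (fun i => (x i : UnitAddCircle)) =
      Complex.exp (2 * Real.pi * Complex.I * (∑ i, (k i : ℝ) * x i : ℝ)) := by
  simp only [UnitAddTorus.mFourier, ContinuousMap.coe_mk, fourier_coe_apply]
  rw [← Complex.exp_sum]
  congr 1
  push_cast
  rw [Finset.mul_sum]
  refine Finset.sum_congr rfl fun i _ => ?_
  ring

/-- The coefficient is an integral over the unit box; as ψ vanishes outside, it extends to the whole
space, and the substitution y = Lx produces the power of L. -/
theorem mFourierCoeff_torusLift (hL : 0 < L) (hsupp : ∀ y, ψ y ≠ 0 → ∀ i, |y i| ≤ L / 4)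
    (k : ι → ℤ) : UnitAddTorus.mFourierCoeff (torusLift L ψ) k =
      (L ^ Fintype.card ι)⁻¹ • 𝓕 ψ (latticePoint L k) := by
  rw [UnitAddTorus.mFourierCoeff_eq_integral _ _ fun _ => (-1 / 2 : ℝ)]
  set G : EuclideanSpace ℝ ι → ℂ := fun y =>
    Complex.exp (-(2 * Real.pi * Complex.I * (inner ℝ y (latticePoint L k) : ℝ))) * ψ y with hG
  have hR : 𝓕 ψ (latticePoint L k) = ∫ y, G y := by
    rw [Real.fourier_eq']
    refine integral_congr_ae (Filter.Eventually.of_forall fun y => ?_)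
    simp only [hG, smul_eq_mul]
    congr 2
    push_cast
    ring
  have hbox : ∀ x ∈ {x : ι → ℝ | ∀ i, x i ∈ Ioc (-1 / 2 : ℝ) (-1 / 2 + 1)},
      UnitAddTorus.mFourier (-k) (fun i => (x i : UnitAddCircle)) •
        torusLift L ψ (fun i => (x i : UnitAddCircle)) = G (L • WithLp.toLp 2 x) := by
    intro x hx
    have hx' : ∀ i, |x i| ≤ 1 / 2 := fun i => abs_le.2
      ⟨by linarith [(hx i).1], by linarith [(hx i).2]⟩
    rw [torusLift_coe hL hsupp hx', mFourier_coe, hG, smul_eq_mul]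
    congr 2
    rw [← mul_neg]
    congr 1
    rw [← Complex.ofReal_neg]
    congr 1
    rw [inner_smul_left, PiLp.inner_apply, Finset.mul_sum, ← Finset.sum_neg_distrib]
    refine Finset.sum_congr rfl fun i _ => ?_
    simp only [latticePoint, Pi.neg_apply, Int.cast_neg, RCLike.inner_apply, conj_trivial]
    field_simp
  have hmeas : MeasurableSet {x : ι → ℝ | ∀ i, x i ∈ Ioc (-1 / 2 : ℝ) (-1 / 2 + 1)} := by
    have : {x : ι → ℝ | ∀ i, x i ∈ Ioc (-1 / 2 : ℝ) (-1 / 2 + 1)} =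
        univ.pi fun _ => Ioc (-1 / 2 : ℝ) (-1 / 2 + 1) := by ext; simp
    rw [this]
    exact MeasurableSet.univ_pi fun _ => measurableSet_Ioc
  rw [setIntegral_congr_fun hmeas hbox, setIntegral_eq_integral_of_forall_compl_eq_zero]
  · have h1 : ∫ x : ι → ℝ, G (L • WithLp.toLp 2 x) = ∫ y : EuclideanSpace ℝ ι, G (L • y) :=
      (PiLp.volume_preserving_toLp ι).integral_comp
        (MeasurableEquiv.toLp 2 (ι → ℝ)).measurableEmbedding fun y => G (L • y)
    rw [h1, Measure.integral_comp_smul, hR, finrank_euclideanSpace,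
      abs_of_pos (by positivity)]
  · intro x hx
    simp only [mem_ofPred_eq, not_forall] at hx
    obtain ⟨i, hi⟩ := hx
    have h0 : ψ (L • WithLp.toLp 2 x) = 0 := by
      by_contra h
      have h1 := hsupp _ h i
      simp only [PiLp.smul_apply, smul_eq_mul, abs_mul, abs_of_pos hL] at h1
      have h2 : |x i| ≤ 1 / 4 := by nlinarith
      rw [abs_le] at h2
      exact hi ⟨by linarith [h2.1], by linarith [h2.2]⟩
    simp [hG, h0]

/-- Fourier series expansion, on a box of side `L`, of a function supported well inside the box. -/
theorem hasSum_fourier_planeWave (hL : 0 < L) (hψ : Continuous ψ)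
    (hsupp : ∀ y, ψ y ≠ 0 → ∀ i, |y i| ≤ L / 4)
    (hsum : Summable fun k : ι → ℤ => 𝓕 ψ (latticePoint L k)) {y : EuclideanSpace ℝ ι}
    (hy : ∀ i, |y i| ≤ L / 2) :
    HasSum (fun k : ι → ℤ => (((L ^ Fintype.card ι)⁻¹ : ℝ) : ℂ) * 𝓕 ψ (latticePoint L k) *
      planeWave (-((2 * Real.pi) • latticePoint L k)) y) (ψ y) := by
  have hco := mFourierCoeff_torusLift hL hsupp
  let F : C(UnitAddTorus ι, ℂ) := ⟨torusLift L ψ, continuous_torusLift hL hψ hsupp⟩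
  have hS : Summable (UnitAddTorus.mFourierCoeff F) := by
    have : UnitAddTorus.mFourierCoeff F =
        fun k => (L ^ Fintype.card ι)⁻¹ • 𝓕 ψ (latticePoint L k) := funext hco
    rw [this]
    exact hsum.const_smul _
  have h := UnitAddTorus.hasSum_mFourier_series_apply_of_summable hS
    (fun i => ((y i / L : ℝ) : UnitAddCircle))
  have hF : F (fun i => ((y i / L : ℝ) : UnitAddCircle)) = ψ y := by
    have h1 := torusLift_coe (ψ := ψ) hL hsupp (x := fun i => y i / L) fun i => by
      rw [abs_div, abs_of_pos hL, div_le_iff₀ hL]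
      linarith [hy i]
    refine h1.trans ?_
    congr 1
    ext i
    simp only [PiLp.smul_apply, smul_eq_mul]
    field_simp
  rw [hF] at h
  convert! h using 2 with k
  rw [show UnitAddTorus.mFourierCoeff F k = _ from hco k, mFourier_coe, smul_eq_mul,
    Complex.real_smul]
  congr 1
  unfold planeWave
  congr 1
  rw [inner_neg_right, inner_smul_right, PiLp.inner_apply, Complex.ofReal_neg, mul_neg, neg_neg,
    Complex.ofReal_mul]
  have h2 : ∑ i, (inner ℝ (y i) (latticePoint L k i) : ℝ) = ∑ i, (k i : ℝ) * (y i / L) := by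
    refine Finset.sum_congr rfl fun i _ => ?_
    simp only [latticePoint, RCLike.inner_apply, conj_trivial]
    ring
  rw [h2]
  push_cast
  ring

end FourierSeries

/-! ### Summability over the frequency lattice. -/

section Lattice

theorem latticePoint_injective {ι : Type*} {L : ℝ} (hL : L ≠ 0) :
    Function.Injective (latticePoint L : (ι → ℤ) → EuclideanSpace ℝ ι) := by
  intro k l hkl
  funext i
  have h2 : latticePoint L k i = latticePoint L l i := by rw [hkl]
  simp only [latticePoint] at h2
  rw [div_left_inj' hL] at h2
  exact_mod_cast h2

variable {ι : Type*} [Fintype ι]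

theorem latticePoint_one_mem_span (k : ι → ℤ) : latticePoint 1 k ∈
    Submodule.span ℤ (range (EuclideanSpace.basisFun ι ℝ).toBasis) := by
  classical
  have h1 : latticePoint 1 k = ∑ i, k i • (EuclideanSpace.basisFun ι ℝ).toBasis i := by
    ext j
    simp [latticePoint, Finset.sum_apply, Pi.single_apply]
  rw [h1]
  exact Submodule.sum_mem _ fun i _ => Submodule.smul_mem _ _ (Submodule.subset_span ⟨i, rfl⟩)

theorem exists_summable_norm_inv_pow_of_mem {κ E : Type*} [NormedAddCommGroup E] [NormedSpace ℝ E]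
    [FiniteDimensional ℝ E] (Λ : Submodule ℤ E) [DiscreteTopology Λ] {f : κ → E}
    (hf : Function.Injective f) (hΛ : ∀ k, f k ∈ Λ) :
    ∃ n : ℕ, Summable fun k => ‖f k‖⁻¹ ^ n := by
  obtain ⟨n, hn⟩ := exists_gt (Module.finrank ℤ Λ)
  have hinj : Function.Injective fun k => (⟨f k, hΛ k⟩ : Λ) :=
    fun _ _ h => hf (congrArg Subtype.val h)
  have h1 : Summable fun z : Λ => ‖(z : E)‖⁻¹ ^ n := ZLattice.summable_norm_pow_inv Λ n hn
  refine ⟨n, ?_⟩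
  have h2 := h1.comp_injective hinj
  simpa only [Function.comp_def] using h2

theorem exists_summable_norm_latticePoint_pow_inv :
    ∃ n : ℕ, Summable fun k : ι → ℤ => ‖latticePoint (1 : ℝ) k‖⁻¹ ^ n :=
  exists_summable_norm_inv_pow_of_mem
    (Submodule.span ℤ (range (EuclideanSpace.basisFun ι ℝ).toBasis))
    (latticePoint_injective one_ne_zero) latticePoint_one_mem_span

/-- Away from k = 0 the exponential is dominated by a multiple of |k|^{-n}, with n large enough for
the lattice sum to converge. -/
theorem summable_exp_neg_norm_latticePoint {s L δ : ℝ} (hs : 0 < s) (hL : 0 < L) (hδ : 0 < δ) :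
    Summable fun k : ι → ℤ => Real.exp (-(δ * ‖latticePoint L k‖ ^ (1 / s))) := by
  obtain ⟨n, hsum⟩ := exists_summable_norm_latticePoint_pow_inv (ι := ι)
  have hscale : ∀ k : ι → ℤ, ‖latticePoint L k‖ = L⁻¹ * ‖latticePoint 1 k‖ := by
    intro k
    have h1 : latticePoint L k = L⁻¹ • latticePoint 1 k := by
      ext i
      simp only [latticePoint, PiLp.smul_apply, smul_eq_mul, div_one]
      rw [div_eq_inv_mul]
    rw [h1, norm_smul, Real.norm_of_nonneg (by positivity)]
  set B := ((s / δ) ^ s) ^ n * (n.factorial : ℝ) ^ s with hB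
  refine Summable.of_norm_bounded_eventually (hsum.mul_left (B * L ^ n)) ?_
  have hfin : ∀ᶠ k : ι → ℤ in Filter.cofinite, k ≠ 0 := by
    simp
  filter_upwards [hfin] with k hk
  have hpos : 0 < ‖latticePoint (1 : ℝ) k‖ := by
    rw [norm_pos_iff]
    intro h
    refine hk (latticePoint_injective one_ne_zero ?_)
    have h0 : latticePoint (1 : ℝ) (0 : ι → ℤ) = 0 := by ext i; simp [latticePoint]
    exact h.trans h0.symm
  rw [Real.norm_of_nonneg (Real.exp_pos _).le, inv_pow, ← div_eq_mul_inv, le_div_iff₀ (by positivity)]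
  have h1 := pow_mul_exp_le_gevrey hs (norm_nonneg (latticePoint L k)) hδ n
  rw [hscale, mul_pow, ← hscale, ← hB, inv_pow, mul_assoc, inv_mul_le_iff₀ (by positivity)] at h1
  linarith

end Lattice

/-! ### Multiplication by a test function as a discrete convolution. -/

section Localization

open scoped FourierTransform

variable {ι : Type*} [Fintype ι] {s : ℝ} {Ω : Set (EuclideanSpace ℝ ι)}

theorem GevreyBoundAt.const_smul {E : Type*} [NormedAddCommGroup E] [NormedSpace ℝ E]
    {A a : ℝ} {f : E → ℂ} {x : E} (hf : ContDiff ℝ ∞ f) (h : GevreyBoundAt s A a f x) (c : ℂ) :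
    GevreyBoundAt s (‖c‖ * A) a (c • f) x := by
  intro k
  rw [iteratedFDeriv_const_smul_apply (hf.of_le (by exact_mod_cast le_top)).contDiffAt, norm_smul,
    mul_assoc]
  gcongr
  exact h k

/-- Since 1/s ≤ 1, the power is subadditive, so a shift of the frequency changes the exponential
weights only by a factor depending on the shift. -/
theorem norm_add_rpow_le {E : Type*} [SeminormedAddCommGroup E] (hs : 1 < s) (x y : E) :
    ‖x + y‖ ^ (1 / s) ≤ ‖x‖ ^ (1 / s) + ‖y‖ ^ (1 / s) := by
  refine (Real.rpow_le_rpow (norm_nonneg _) (norm_add_le x y) (by positivity)).trans ?_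
  exact Real.rpow_add_le_add_rpow (norm_nonneg _) (norm_nonneg _) (by positivity)
    (by rw [div_le_one (by linarith)]; exact hs.le)

/-- Multiplication by a test function `ψ` acts on the Fourier transform of `χu` as a discrete
convolution with a kernel of exponential decay of order `1/s`. -/
theorem exists_hasSum_fourierCutoff_mul (hs : 1 < s) (u : Ultradistribution s Ω)
    (χ ψ : GevreyTest s Ω) :
    ∃ (τ : (ι → ℤ) → EuclideanSpace ℝ ι) (c : (ι → ℤ) → ℂ) (A δ : ℝ), 0 ≤ A ∧ 0 < δ ∧
      (∀ k, ‖c k‖ ≤ A * Real.exp (-(δ * ‖τ k‖ ^ (1 / s)))) ∧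
      (∀ ε : ℝ, 0 < ε → Summable fun k => Real.exp (-(ε * ‖τ k‖ ^ (1 / s)))) ∧
      ∀ ξ, HasSum (fun k => c k * fourierCutoff hs u χ (ξ + τ k))
        (fourierCutoff hs u (GevreyTest.mul (by linarith) χ ψ) ξ) := by
  have hs0 : 0 < s := by linarith
  set K := tsupport (χ : EuclideanSpace ℝ ι → ℂ) ∪ tsupport (ψ : EuclideanSpace ℝ ι → ℂ)
  have hK : IsCompact K := χ.2.2.1.isCompact.union ψ.2.2.1.isCompact
  obtain ⟨r, hr⟩ := hK.isBounded.exists_norm_le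
  -- Both supports lie in the inner half of the box, so the lift of ψ is continuous and its series
  -- represents ψ on supp χ.
  set L : ℝ := 4 * (|r| + 1) with hLdef
  have hL : 0 < L := by positivity
  have hKL : ∀ y ∈ K, ∀ i, |y i| ≤ L / 4 := by
    intro y hy i
    have h1 : |y i| ≤ ‖y‖ := PiLp.norm_apply_le y i
    have h2 := (hr y hy).trans (le_abs_self r)
    rw [hLdef]
    linarith
  have hsupp : ∀ y, (ψ : EuclideanSpace ℝ ι → ℂ) y ≠ 0 → ∀ i, |y i| ≤ L / 4 := fun y hy =>
    hKL y (Or.inr (subset_tsupport _ hy))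
  obtain ⟨B, b, hB, hb, hψb⟩ := GevreyTest.exists_gevreyBoundAt hs0.le ψ
  obtain ⟨C₀, δ₀, hC₀, hδ₀, hF⟩ := exists_norm_fourier_le_exp hs0 ψ.2.2.1.isCompact.isBounded hb
  have hdecay := hF ψ ψ.2.1 ψ.2.2.1 subset_rfl B hB hψb
  have hsum : Summable fun k : ι → ℤ => 𝓕 (ψ : EuclideanSpace ℝ ι → ℂ) (latticePoint L k) :=
    Summable.of_norm_bounded ((summable_exp_neg_norm_latticePoint hs0 hL hδ₀).mul_left (C₀ * B))
      fun k => hdecay _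
  -- Sign and factor 2π rewrite e^{2πi⟨k/L,y⟩} as the plane wave e^{-i⟨y,τ_k⟩}.
  set τ : (ι → ℤ) → EuclideanSpace ℝ ι := fun k => -((2 * Real.pi) • latticePoint L k) with hτ
  have hτn : ∀ k, ‖τ k‖ ^ (1 / s) = (2 * Real.pi) ^ (1 / s) * ‖latticePoint L k‖ ^ (1 / s) := by
    intro k
    rw [hτ, norm_neg, norm_smul, Real.norm_of_nonneg (by positivity),
      Real.mul_rpow (by positivity) (norm_nonneg _)]
  set c : (ι → ℤ) → ℂ := fun k => (((L ^ Fintype.card ι)⁻¹ : ℝ) : ℂ) *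
    𝓕 (ψ : EuclideanSpace ℝ ι → ℂ) (latticePoint L k) with hc
  set δ : ℝ := δ₀ / (2 * Real.pi) ^ (1 / s) with hδdef
  have hδ : 0 < δ := by positivity
  have hτsum : ∀ ε : ℝ, 0 < ε → Summable fun k => Real.exp (-(ε * ‖τ k‖ ^ (1 / s))) := by
    intro ε hε
    have h1 := summable_exp_neg_norm_latticePoint (ι := ι) hs0 hL
      (δ := ε * (2 * Real.pi) ^ (1 / s)) (by positivity)
    refine h1.congr fun k => ?_
    rw [hτn, mul_assoc]
  set A : ℝ := (L ^ Fintype.card ι)⁻¹ * (C₀ * B) with hA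
  have hcA : ∀ k, ‖c k‖ ≤ A * Real.exp (-(δ * ‖τ k‖ ^ (1 / s))) := by
    intro k
    have h1 : δ * ‖τ k‖ ^ (1 / s) = δ₀ * ‖latticePoint L k‖ ^ (1 / s) := by
      rw [hτn, hδdef]
      field_simp
    rw [h1, hc, norm_mul, Complex.norm_real, Real.norm_of_nonneg (by positivity), hA, mul_assoc]
    exact mul_le_mul_of_nonneg_left (hdecay _) (by positivity)
  refine ⟨τ, c, A, δ, by positivity, hδ, hcA, hτsum, fun ξ => ?_⟩
  -- Growth rate δ/2: half of the decay of c_k absorbs the growth of the modulated tests in τ_k, and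
  -- the other half makes the series summable.
  obtain ⟨D, d, hD, hd, hχb⟩ := exists_gevreyBoundAt_modulatedTest hs χ (half_pos hδ)
  have hbnd : ∀ k, ‖c k‖ * (D * Real.exp (δ / 2 * ‖ξ + τ k‖ ^ (1 / s))) ≤
      A * D * Real.exp (δ / 2 * ‖ξ‖ ^ (1 / s)) * Real.exp (-(δ / 2 * ‖τ k‖ ^ (1 / s))) := by
    intro k
    calc ‖c k‖ * (D * Real.exp (δ / 2 * ‖ξ + τ k‖ ^ (1 / s)))
        ≤ (A * Real.exp (-(δ * ‖τ k‖ ^ (1 / s)))) *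
            (D * Real.exp (δ / 2 * (‖ξ‖ ^ (1 / s) + ‖τ k‖ ^ (1 / s)))) := by
          gcongr
          · exact hcA k
          · exact norm_add_rpow_le hs _ _
      _ = _ := by
          have h1 : Real.exp (-(δ / 2 * ‖τ k‖ ^ (1 / s))) = Real.exp (-(δ * ‖τ k‖ ^ (1 / s))) *
              Real.exp (δ / 2 * ‖τ k‖ ^ (1 / s)) := by
            rw [← Real.exp_add]; congr 1; ring
          rw [h1, mul_add, Real.exp_add]
          ring
  have hχs : tsupport (χ : EuclideanSpace ℝ ι → ℂ) ⊆ Ω := χ.2.2.2.1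
  have hmain := u.hasSum_of_gevreyBoundAt hs0.le χ.2.2.1.isCompact hχs hd
    (f := fun k => c k • modulatedTest hs χ (ξ + τ k))
    (g := modulatedTest hs (GevreyTest.mul hs0.le χ ψ) ξ)
    (a := fun k => ‖c k‖ * (D * Real.exp (δ / 2 * ‖ξ + τ k‖ ^ (1 / s))))
    (fun k => by positivity)
    (Summable.of_nonneg_of_le (fun k => by positivity) hbnd ((hτsum _ (half_pos hδ)).mul_left _))
    (fun k => (closure_mono (Function.support_const_smul_subset (c k)
      (modulatedTest hs χ (ξ + τ k) : EuclideanSpace ℝ ι → ℂ))).trans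
        (tsupport_modulatedTest_subset hs χ _))
    ((tsupport_modulatedTest_subset hs _ ξ).trans
      (tsupport_mul_subset_left (f := (χ : EuclideanSpace ℝ ι → ℂ))))
    (fun k x => (hχb (ξ + τ k) x).const_smul (modulatedTest hs χ (ξ + τ k)).2.1 (c k)) ?_
  · simpa only [map_smul, smul_eq_mul] using! hmain
  · intro y
    have hpt : ∀ k, ((c k • modulatedTest hs χ (ξ + τ k) : GevreyTest s Ω) :
        EuclideanSpace ℝ ι → ℂ) y =
        (χ : EuclideanSpace ℝ ι → ℂ) y * planeWave ξ y * (c k * planeWave (τ k) y) := by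
      intro k
      rw [Submodule.coe_smul, Pi.smul_apply, modulatedTest_apply, planeWave_add, smul_eq_mul]
      ring
    simp only [hpt]
    have hg : (modulatedTest hs (GevreyTest.mul hs0.le χ ψ) ξ : EuclideanSpace ℝ ι → ℂ) y =
        (χ : EuclideanSpace ℝ ι → ℂ) y * planeWave ξ y * (ψ : EuclideanSpace ℝ ι → ℂ) y := by
      rw [modulatedTest_apply]
      simp only [GevreyTest.mul]
      ring
    rw [hg]
    -- The Fourier series is only used inside the box; off supp χ both sides vanish through the
    -- factor χ.
    by_cases hy : y ∈ tsupport (χ : EuclideanSpace ℝ ι → ℂ)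
    · have h1 := hasSum_fourier_planeWave hL ψ.2.1.continuous hsupp hsum (y := y)
        fun i => (hKL y (Or.inl hy) i).trans (by linarith)
      exact ((h1.mul_left ((χ : EuclideanSpace ℝ ι → ℂ) y * planeWave ξ y)).tsum_eq).symm
    · rw [image_eq_zero_of_notMem_tsupport hy]
      simp

end Localization

/-! ### Exponential decay on cones. -/

section Cones

/-- Decay `|g(ξ)| ≤ C e^{-ε|ξ|^{1/s}}` on the set `Γ`. -/
def DecaysOn {E : Type*} [Norm E] (s : ℝ) (Γ : Set E) (g : E → ℂ) : Prop :=
  ∃ C ε : ℝ, 0 ≤ C ∧ 0 < ε ∧ ∀ ξ ∈ Γ, ‖g ξ‖ ≤ C * Real.exp (-(ε * ‖ξ‖ ^ (1 / s)))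

/-- The open cone generated by a set. -/
def coneOver {E : Type*} [SMul ℝ E] (O : Set E) : Set E :=
  {ξ | ∃ r : ℝ, 0 < r ∧ ∃ η ∈ O, ξ = r • η}

theorem coneOver_mono {E : Type*} [SMul ℝ E] {O O' : Set E} (h : O ⊆ O') :
    coneOver O ⊆ coneOver O' :=
  fun _ ⟨r, hr, η, hη, e⟩ => ⟨r, hr, η, h hη, e⟩

theorem DecaysOn.mono {E : Type*} [Norm E] {s : ℝ} {Γ Γ' : Set E} {g : E → ℂ}
    (h : DecaysOn s Γ g) (hΓ : Γ' ⊆ Γ) : DecaysOn s Γ' g := by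
  obtain ⟨C, ε, hC, hε, hb⟩ := h
  exact ⟨C, ε, hC, hε, fun ξ hξ => hb ξ (hΓ hξ)⟩

variable {E : Type*} [SeminormedAddCommGroup E] {s : ℝ}

theorem mul_exp_le_mul_exp {C C' ε ε' w : ℝ} (hC : C ≤ C') (hC' : 0 ≤ C') (hε : ε' ≤ ε)
    (hw : 0 ≤ w) : C * Real.exp (-(ε * w)) ≤ C' * Real.exp (-(ε' * w)) := by
  gcongr

theorem DecaysOn.union {Γ Γ' : Set E} {g : E → ℂ} (h : DecaysOn s Γ g) (h' : DecaysOn s Γ' g) :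
    DecaysOn s (Γ ∪ Γ') g := by
  obtain ⟨C, ε, hC, hε, hb⟩ := h
  obtain ⟨C', ε', hC', hε', hb'⟩ := h'
  refine ⟨C + C', min ε ε', by positivity, lt_min hε hε', fun ξ hξ => ?_⟩
  rcases hξ with hξ | hξ
  · exact (hb ξ hξ).trans (mul_exp_le_mul_exp (by linarith) (by positivity) (min_le_left _ _)
      (by positivity))
  · exact (hb' ξ hξ).trans (mul_exp_le_mul_exp (by linarith) (by positivity) (min_le_right _ _)
      (by positivity))

theorem DecaysOn.add {Γ : Set E} {f g : E → ℂ} (h : DecaysOn s Γ f) (h' : DecaysOn s Γ g) :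
    DecaysOn s Γ (f + g) := by
  obtain ⟨C, ε, hC, hε, hb⟩ := h
  obtain ⟨C', ε', hC', hε', hb'⟩ := h'
  refine ⟨C + C', min ε ε', by positivity, lt_min hε hε', fun ξ hξ => ?_⟩
  rw [add_mul]
  refine (norm_add_le _ _).trans (add_le_add ?_ ?_)
  · exact (hb ξ hξ).trans (mul_exp_le_mul_exp le_rfl hC (min_le_left _ _) (by positivity))
  · exact (hb' ξ hξ).trans (mul_exp_le_mul_exp le_rfl hC' (min_le_right _ _) (by positivity))

end Cones

/-! ### Conic decay passes from local cutoffs to λ. -/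

section Localization

variable {ι : Type*} [Fintype ι] {s : ℝ} {Ω : Set (EuclideanSpace ℝ ι)}

/-- If `ℱ(χu)` decays in an open cone, then `ℱ(χψu)` decays in a smaller cone which does not depend
on `ψ`. -/
theorem exists_decaysOn_fourierCutoff_mul (hs : 1 < s) (u : Ultradistribution s Ω)
    (χ : GevreyTest s Ω) {Γ : Set (EuclideanSpace ℝ ι)} (hΓ : IsOpen Γ)
    (hcone : ∀ r : ℝ, 0 < r → ∀ ξ ∈ Γ, r • ξ ∈ Γ) (hdec : DecaysOn s Γ (fourierCutoff hs u χ))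
    {ξ₀ : EuclideanSpace ℝ ι} (hξ₀ : ξ₀ ∈ Γ) :
    ∃ ρ : ℝ, 0 < ρ ∧ ∀ ψ : GevreyTest s Ω, DecaysOn s (coneOver (Metric.ball ξ₀ ρ))
      (fourierCutoff hs u (GevreyTest.mul (by linarith) χ ψ)) := by
  have hs0 : 0 < s := by linarith
  obtain ⟨ρ₀, hρ₀, hball⟩ := Metric.isOpen_iff.1 hΓ ξ₀ hξ₀
  set ρ := ρ₀ / 2 with hρdef
  have hρ : 0 < ρ := by positivity
  refine ⟨ρ, hρ, fun ψ => ?_⟩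
  obtain ⟨τ, c, A, δ, hA, hδ, hcA, hτ, hsum⟩ := exists_hasSum_fourierCutoff_mul hs u χ ψ
  obtain ⟨C, ε, hC, hε, hb⟩ := hdec
  -- The sum is split at |τ_k| = κ|ξ|. Below it, the second bound keeps ξ + τ_k in Γ, and 1/2 gives
  -- |ξ + τ_k| ≥ |ξ|/2.
  set κ : ℝ := min (1 / 2) (ρ / (‖ξ₀‖ + ρ)) with hκ
  have hκ0 : 0 < κ := lt_min (by norm_num) (by positivity)
  set M : ℝ := (1 / κ) ^ (1 / s) with hM
  have hM0 : 0 < M := by positivity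
  -- For large shifts |ξ|^{1/s} ≤ M|τ_k|^{1/s}. The decay δ of c_k is then spent as δ/4 on the
  -- growth of ℱ(χu), δ/4 on decay in ξ at rate ε₂, and δ/2 on summability.
  set ε₁ : ℝ := δ / (4 * (M + 1)) with hε₁
  have hε₁0 : 0 < ε₁ := by positivity
  obtain ⟨D, hD, hgrow⟩ := exists_norm_fourierCutoff_le hs u χ hε₁0
  set ε₂ : ℝ := min (ε * (1 / 2) ^ (1 / s)) (δ / (4 * M)) with hε₂
  have hε₂0 : 0 < ε₂ := lt_min (by positivity) (by positivity)
  have hterm : ∀ ξ ∈ coneOver (Metric.ball ξ₀ ρ), ∀ k,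
      ‖c k * fourierCutoff hs u χ (ξ + τ k)‖ ≤
        A * (C + D) * Real.exp (-(ε₂ * ‖ξ‖ ^ (1 / s))) *
          Real.exp (-(δ / 2 * ‖τ k‖ ^ (1 / s))) := by
    rintro ξ ⟨r, hr, η, hη, rfl⟩ k
    set ξ := r • η with hξ
    rw [norm_mul]
    by_cases hk : ‖τ k‖ < κ * ‖ξ‖
    · have hηn : ‖η‖ ≤ ‖ξ₀‖ + ρ := by
        have h1 : ‖η - ξ₀‖ < ρ := by simpa [dist_eq_norm] using hη
        have h2 := norm_le_norm_add_norm_sub ξ₀ η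
        rw [norm_sub_rev] at h1
        linarith
      have hξn : ‖ξ‖ = r * ‖η‖ := by rw [hξ, norm_smul, Real.norm_of_nonneg hr.le]
      have hτr : ‖τ k‖ < ρ * r := by
        calc ‖τ k‖ < κ * ‖ξ‖ := hk
          _ ≤ ρ / (‖ξ₀‖ + ρ) * (r * (‖ξ₀‖ + ρ)) := by
            rw [hξn]
            gcongr
            exact min_le_right _ _
          _ = ρ * r := by field_simp
      have hmem : ξ + τ k ∈ Γ := by
        have h1 : ξ + τ k = r • (η + r⁻¹ • τ k) := by
          rw [smul_add, smul_smul, mul_inv_cancel₀ hr.ne', one_smul]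
        rw [h1]
        refine hcone r hr _ (hball ?_)
        rw [Metric.mem_ball, dist_eq_norm]
        have h2 : ‖η - ξ₀‖ < ρ := by simpa [dist_eq_norm] using hη
        have h3 : ‖r⁻¹ • τ k‖ < ρ := by
          rw [norm_smul, Real.norm_of_nonneg (by positivity), inv_mul_lt_iff₀ hr]
          linarith
        calc ‖η + r⁻¹ • τ k - ξ₀‖ = ‖(η - ξ₀) + r⁻¹ • τ k‖ := by congr 1; abel
          _ ≤ ‖η - ξ₀‖ + ‖r⁻¹ • τ k‖ := norm_add_le _ _
          _ < ρ + ρ := add_lt_add h2 h3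
          _ = ρ₀ := by rw [hρdef]; ring
      have hhalf : 1 / 2 * ‖ξ‖ ≤ ‖ξ + τ k‖ := by
        have h1 : ‖τ k‖ ≤ 1 / 2 * ‖ξ‖ :=
          hk.le.trans (mul_le_mul_of_nonneg_right (min_le_left _ _) (norm_nonneg _))
        have h2 := norm_sub_le (ξ + τ k) (τ k)
        rw [add_sub_cancel_right] at h2
        linarith
      have hw : (1 / 2 : ℝ) ^ (1 / s) * ‖ξ‖ ^ (1 / s) ≤ ‖ξ + τ k‖ ^ (1 / s) := by
        rw [← Real.mul_rpow (by norm_num) (norm_nonneg _)]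
        gcongr
      have h4 : ‖fourierCutoff hs u χ (ξ + τ k)‖ ≤ (C + D) * Real.exp (-(ε₂ * ‖ξ‖ ^ (1 / s))) := by
        refine (hb _ hmem).trans (mul_le_mul (by linarith)
          (Real.exp_le_exp.2 (neg_le_neg ?_)) (Real.exp_pos _).le (by positivity))
        calc ε₂ * ‖ξ‖ ^ (1 / s) ≤ ε * (1 / 2) ^ (1 / s) * ‖ξ‖ ^ (1 / s) :=
              mul_le_mul_of_nonneg_right (min_le_left _ _) (by positivity)
          _ = ε * ((1 / 2) ^ (1 / s) * ‖ξ‖ ^ (1 / s)) := by ring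
          _ ≤ _ := mul_le_mul_of_nonneg_left hw hε.le
      calc ‖c k‖ * ‖fourierCutoff hs u χ (ξ + τ k)‖
          ≤ (A * Real.exp (-(δ / 2 * ‖τ k‖ ^ (1 / s)))) *
              ((C + D) * Real.exp (-(ε₂ * ‖ξ‖ ^ (1 / s)))) := by
            gcongr
            exact (hcA k).trans (mul_exp_le_mul_exp le_rfl hA (by linarith) (by positivity))
        _ = _ := by ring
    · push Not at hk
      have hw : ‖ξ‖ ^ (1 / s) ≤ M * ‖τ k‖ ^ (1 / s) := by
        rw [hM, ← Real.mul_rpow (by positivity) (norm_nonneg _)]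
        gcongr
        rw [one_div_mul_eq_div, le_div_iff₀ hκ0]
        linarith
      set x := ‖ξ‖ ^ (1 / s) with hx
      set t := ‖τ k‖ ^ (1 / s) with ht
      have hx0 : 0 ≤ x := by positivity
      have ht0 : 0 ≤ t := by positivity
      have h1 : ‖fourierCutoff hs u χ (ξ + τ k)‖ ≤ D * Real.exp (δ / 4 * t) := by
        refine (hgrow _).trans (mul_le_mul_of_nonneg_left (Real.exp_le_exp.2 ?_) hD)
        calc ε₁ * ‖ξ + τ k‖ ^ (1 / s) ≤ ε₁ * (M * t + t) := by
              gcongr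
              exact (norm_add_rpow_le hs _ _).trans (by linarith)
          _ = δ / 4 * t := by rw [hε₁]; field_simp
      have h2 : ε₂ * x ≤ δ / 4 * t := by
        calc ε₂ * x ≤ δ / (4 * M) * (M * t) := by
              gcongr; exact min_le_right _ _
          _ = δ / 4 * t := by field_simp
      calc ‖c k‖ * ‖fourierCutoff hs u χ (ξ + τ k)‖
          ≤ (A * Real.exp (-(δ * t))) * (D * Real.exp (δ / 4 * t)) := by
            gcongr; exact hcA k
        _ = A * D * Real.exp (-(δ * t) + δ / 4 * t) := by rw [Real.exp_add]; ring
        _ ≤ A * (C + D) * Real.exp (-(ε₂ * x) + -(δ / 2 * t)) :=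
            mul_le_mul (mul_le_mul_of_nonneg_left (by linarith) hA)
              (Real.exp_le_exp.2 (by linarith)) (Real.exp_pos _).le (by positivity)
        _ = _ := by rw [Real.exp_add]; ring
  refine ⟨A * (C + D) * ∑' k, Real.exp (-(δ / 2 * ‖τ k‖ ^ (1 / s))), ε₂,
    mul_nonneg (by positivity) (tsum_nonneg fun _ => (Real.exp_pos _).le), hε₂0, fun ξ hξ => ?_⟩
  have h1 := (hτ _ (half_pos hδ)).hasSum.mul_left (A * (C + D) * Real.exp (-(ε₂ * ‖ξ‖ ^ (1 / s))))
  rw [← (hsum ξ).tsum_eq]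
  exact (tsum_of_norm_bounded h1 (hterm ξ hξ)).trans (le_of_eq (by ring))

theorem fourierCutoff_add (hs : 1 < s) (u : Ultradistribution s Ω) (χ ψ : GevreyTest s Ω) :
    fourierCutoff hs u (χ + ψ) = fourierCutoff hs u χ + fourierCutoff hs u ψ := by
  funext ξ
  simp only [fourierCutoff, Pi.add_apply]
  rw [← map_add]
  congr 1
  ext y
  simp only [modulatedTest_apply, Submodule.coe_add, Pi.add_apply]
  ring

/-- This replaces a partition of unity. In lam = χ lam + (1 - χ) lam the first term is handled by
the localization above; the second vanishes where χ = 1, so the remaining cutoffs suffice for it. -/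
theorem exists_decaysOn_fourierCutoff_of_finset (hs : 1 < s) (u : Ultradistribution s Ω)
    {ξ₀ : EuclideanSpace ℝ ι} (T : Finset (GevreyTest s Ω))
    (hT : ∀ χ ∈ T, ∃ Γ : Set (EuclideanSpace ℝ ι), IsOpen Γ ∧ ξ₀ ∈ Γ ∧
      (∀ r : ℝ, 0 < r → ∀ ξ ∈ Γ, r • ξ ∈ Γ) ∧ DecaysOn s Γ (fourierCutoff hs u χ)) :
    ∀ lam : GevreyTest s Ω, (∀ y, (lam : EuclideanSpace ℝ ι → ℂ) y ≠ 0 →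
      ∃ χ ∈ T, (χ : EuclideanSpace ℝ ι → ℂ) y = 1) →
    ∃ ρ : ℝ, 0 < ρ ∧ DecaysOn s (coneOver (Metric.ball ξ₀ ρ)) (fourierCutoff hs u lam) := by
  classical
  induction T using Finset.induction_on with
  | empty =>
    intro lam hlam
    have h0 : lam = 0 := by
      ext y
      by_contra h
      obtain ⟨χ, hχ, -⟩ := hlam y h
      exact absurd hχ (Finset.notMem_empty _)
    refine ⟨1, one_pos, 0, 1, le_rfl, one_pos, fun ξ _ => ?_⟩
    have h1 : modulatedTest hs (0 : GevreyTest s Ω) ξ = 0 := by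
      ext y
      simp [modulatedTest_apply]
    rw [h0, fourierCutoff, h1, map_zero, norm_zero, zero_mul]
  | insert χ T _ ih =>
    intro lam hlam
    have hs0 : 0 ≤ s := by linarith
    obtain ⟨Γ, hΓ, hξ₀, hcone, hdec⟩ := hT χ (Finset.mem_insert_self _ _)
    obtain ⟨ρ, hρ, hmul⟩ := exists_decaysOn_fourierCutoff_mul hs u χ hΓ hcone hdec hξ₀
    obtain ⟨ρ', hρ', hdec'⟩ := ih (fun χ' h => hT χ' (Finset.mem_insert_of_mem h))
      (lam - GevreyTest.mul hs0 χ lam) (by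
        intro y hy
        have h1 : ((lam - GevreyTest.mul hs0 χ lam : GevreyTest s Ω) :
            EuclideanSpace ℝ ι → ℂ) y =
            (1 - (χ : EuclideanSpace ℝ ι → ℂ) y) * (lam : EuclideanSpace ℝ ι → ℂ) y := by
          simp only [Submodule.coe_sub, Pi.sub_apply, GevreyTest.mul]
          ring
        rw [h1] at hy
        obtain ⟨χ', hχ', h2⟩ := hlam y (right_ne_zero_of_mul hy)
        rcases Finset.mem_insert.1 hχ' with rfl | h3
        · rw [h2, sub_self, zero_mul] at hy
          exact absurd rfl hy
        · exact ⟨χ', h3, h2⟩)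
    refine ⟨min ρ ρ', lt_min hρ hρ', ?_⟩
    have h2 : lam = GevreyTest.mul hs0 χ lam + (lam - GevreyTest.mul hs0 χ lam) := by abel
    rw [h2, fourierCutoff_add]
    exact ((hmul lam).mono (coneOver_mono (Metric.ball_subset_ball (min_le_left _ _)))).add
      (hdec'.mono (coneOver_mono (Metric.ball_subset_ball (min_le_right _ _))))

/-- If `u` is microlocally Gevrey at `(y, ξ₀)` for all `y` in the support of `lam`, then
`ℱ(lam u)` decays in a conic neighbourhood of `ξ₀`. -/
theorem exists_decaysOn_fourierCutoff (hs : 1 < s) (u : Ultradistribution s Ω)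
    {ξ₀ : EuclideanSpace ℝ ι} (lam : GevreyTest s Ω)
    (hreg : ∀ y ∈ tsupport (lam : EuclideanSpace ℝ ι → ℂ), MicrolocallyGevreyAt hs u y ξ₀) :
    ∃ ρ : ℝ, 0 < ρ ∧ DecaysOn s (coneOver (Metric.ball ξ₀ ρ)) (fourierCutoff hs u lam) := by
  classical
  have hreg' : ∀ y : EuclideanSpace ℝ ι, ∃ χ : GevreyTest s Ω,
      y ∈ tsupport (lam : EuclideanSpace ℝ ι → ℂ) →
      (∀ᶠ z in 𝓝 y, (χ : EuclideanSpace ℝ ι → ℂ) z = 1) ∧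
      ∃ Γ : Set (EuclideanSpace ℝ ι), IsOpen Γ ∧ ξ₀ ∈ Γ ∧
        (∀ r : ℝ, 0 < r → ∀ ξ ∈ Γ, r • ξ ∈ Γ) ∧ DecaysOn s Γ (fourierCutoff hs u χ) := by
    intro y
    by_cases hy : y ∈ tsupport (lam : EuclideanSpace ℝ ι → ℂ)
    · obtain ⟨χ, h1, Γ, hΓ, hξ, hcone, C, ε, hε, hb⟩ := hreg y hy
      refine ⟨χ, fun _ => ⟨h1, Γ, hΓ, hξ, hcone, |C|, ε, abs_nonneg _, hε, fun ξ hξ => ?_⟩⟩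
      exact (hb ξ hξ).trans (mul_le_mul_of_nonneg_right (le_abs_self C) (Real.exp_pos _).le)
    · exact ⟨0, fun h => absurd h hy⟩
  choose χ hχ using hreg'
  have hU : ∀ y ∈ tsupport (lam : EuclideanSpace ℝ ι → ℂ),
      {z | (χ y : EuclideanSpace ℝ ι → ℂ) z = 1} ∈ 𝓝 y := fun y hy => (hχ y hy).1
  obtain ⟨t, ht, hcover⟩ := lam.2.2.1.isCompact.elim_nhds_subcover _ hU
  refine exists_decaysOn_fourierCutoff_of_finset hs u (t.image χ) ?_ lam ?_
  · intro χ' hχ'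
    obtain ⟨y, hy, rfl⟩ := Finset.mem_image.1 hχ'
    exact (hχ y (ht y hy)).2
  · intro y hy
    have h1 := hcover (subset_tsupport _ hy)
    simp only [mem_iUnion] at h1
    obtain ⟨z, hz, hzy⟩ := h1
    exact ⟨χ z, Finset.mem_image_of_mem _ hz, hzy⟩

/-- If `ℱ(lam u)` decays in a conic neighbourhood of each point of a compact set `S`, then it decays
in a common conic neighbourhood of `S`. -/
theorem exists_decaysOn_coneOver_thickening {E : Type*} [SeminormedAddCommGroup E]
    [NormedSpace ℝ E] {g : E → ℂ} {S : Set E} (hS : IsCompact S)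
    (h : ∀ ξ₀ ∈ S, ∃ ρ : ℝ, 0 < ρ ∧ DecaysOn s (coneOver (Metric.ball ξ₀ ρ)) g) :
    ∃ c : ℝ, 0 < c ∧ DecaysOn s (coneOver (Metric.thickening c S)) g := by
  obtain ⟨O, hO, hSO, hdec⟩ : ∃ O : Set E, IsOpen O ∧ S ⊆ O ∧ DecaysOn s (coneOver O) g := by
    refine hS.induction_on (p := fun T => ∃ O : Set E, IsOpen O ∧ T ⊆ O ∧ DecaysOn s (coneOver O) g)
      ?_ ?_ ?_ ?_
    · exact ⟨∅, isOpen_empty, subset_rfl, 0, 1, le_rfl, one_pos,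
        fun ξ ⟨_, _, _, h, _⟩ => absurd h (notMem_empty _)⟩
    · rintro T T' hTT' ⟨O, hO, hT', hd⟩
      exact ⟨O, hO, hTT'.trans hT', hd⟩
    · rintro T T' ⟨O, hO, hT, hd⟩ ⟨O', hO', hT', hd'⟩
      refine ⟨O ∪ O', hO.union hO', union_subset_union hT hT', (hd.union hd').mono ?_⟩
      rintro ξ ⟨r, hr, η, hη | hη, e⟩
      · exact Or.inl ⟨r, hr, η, hη, e⟩
      · exact Or.inr ⟨r, hr, η, hη, e⟩
    · intro ξ₀ hξ₀
      obtain ⟨ρ, hρ, hd⟩ := h ξ₀ hξ₀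
      exact ⟨Metric.ball ξ₀ ρ, mem_nhdsWithin_of_mem_nhds (Metric.ball_mem_nhds _ hρ), _,
        Metric.isOpen_ball, subset_rfl, hd⟩
  obtain ⟨c, hc, hsub⟩ := hS.exists_thickening_subset_open hO hSO
  exact ⟨c, hc, hdec.mono (coneOver_mono hsub)⟩

end Localization

/-! ### Fourier integrals of exponentially decaying amplitudes. -/

section FourierIntegrals

variable {V : Type*} [NormedAddCommGroup V] [NormedSpace ℝ V] [FiniteDimensional ℝ V]
  [MeasurableSpace V] [BorelSpace V] {μ : Measure V} [μ.IsAddHaarMeasure]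

theorem integrable_exp_neg_norm_rpow {s δ : ℝ} (hs : 0 < s) (hδ : 0 < δ) :
    Integrable (fun v : V => Real.exp (-(δ * ‖v‖ ^ (1 / s)))) μ := by
  set n := Module.finrank ℝ V + 1 with hn
  have h1 : Integrable (fun v : V => (1 + ‖v‖) ^ (-(n : ℝ))) μ :=
    integrable_one_add_norm (by rw [hn]; push_cast; linarith)
  set B := ((s / δ) ^ s) ^ n * (n.factorial : ℝ) ^ s with hB
  have hexp : Continuous fun v : V => Real.exp (-(δ * ‖v‖ ^ (1 / s))) := by
    refine Real.continuous_exp.comp (continuous_const.mul ?_).neg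
    exact continuous_norm.rpow_const fun _ => Or.inr (by positivity)
  refine (h1.const_mul (2 ^ n * (1 + B))).mono' hexp.aestronglyMeasurable
    (Filter.Eventually.of_forall fun v => ?_)
  rw [Real.norm_of_nonneg (Real.exp_pos _).le, Real.rpow_neg (by positivity), Real.rpow_natCast,
    ← div_eq_mul_inv, le_div_iff₀ (by positivity)]
  have h2 := pow_mul_exp_le_gevrey hs (norm_nonneg v) hδ n
  have h3 : (1 + ‖v‖) ^ n ≤ 2 ^ n * (1 + ‖v‖ ^ n) := by
    have h4 := add_pow_le (zero_le_one (α := ℝ)) (norm_nonneg v) n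
    rw [one_pow] at h4
    refine h4.trans ?_
    gcongr
    · norm_num
    · omega
  have h5 : Real.exp (-(δ * ‖v‖ ^ (1 / s))) ≤ 1 := Real.exp_le_one_iff.2 (by
    have : 0 ≤ δ * ‖v‖ ^ (1 / s) := by positivity
    linarith)
  calc Real.exp (-(δ * ‖v‖ ^ (1 / s))) * (1 + ‖v‖) ^ n
      ≤ Real.exp (-(δ * ‖v‖ ^ (1 / s))) * (2 ^ n * (1 + ‖v‖ ^ n)) := by gcongr
    _ = 2 ^ n * (Real.exp (-(δ * ‖v‖ ^ (1 / s))) + ‖v‖ ^ n * Real.exp (-(δ * ‖v‖ ^ (1 / s)))) := by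
      ring
    _ ≤ 2 ^ n * (1 + B) := by gcongr

variable {W : Type*} [NormedAddCommGroup W] [NormedSpace ℝ W]

/-- The Fourier integral of a function decaying like `e^{-δ|v|^{1/s}}` is a Gevrey function of
order `s`. -/
theorem contDiff_gevreyBoundAt_fourierIntegral {s δ A : ℝ} (hs : 0 < s) (hδ : 0 < δ)
    (L : V →L[ℝ] W →L[ℝ] ℝ) {G : V → ℂ} (hG : AEStronglyMeasurable G μ)
    (hGb : ∀ v, ‖G v‖ ≤ A * Real.exp (-(δ * ‖v‖ ^ (1 / s)))) :
    ContDiff ℝ ∞ (VectorFourier.fourierIntegral Real.fourierChar μ L.toLinearMap₁₂ G) ∧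
      ∀ w, GevreyBoundAt s (A * ∫ v, Real.exp (-(δ / 2 * ‖v‖ ^ (1 / s))) ∂μ)
        (2 * Real.pi * ‖L‖ * (s / (δ / 2)) ^ s)
        (VectorFourier.fourierIntegral Real.fourierChar μ L.toLinearMap₁₂ G) w := by
  have hA : 0 ≤ A := by
    have h := (norm_nonneg _).trans (hGb 0)
    exact nonneg_of_mul_nonneg_left h (Real.exp_pos _)
  -- Half of the decay turns ‖v‖^k into b^k k!^s; the other half remains to be integrated.
  have hbk : ∀ (k : ℕ) (v : V), ‖v‖ ^ k * ‖G v‖ ≤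
      A * (((s / (δ / 2)) ^ s) ^ k * (k.factorial : ℝ) ^ s) *
        Real.exp (-(δ / 2 * ‖v‖ ^ (1 / s))) := by
    intro k v
    have h1 : Real.exp (-(δ * ‖v‖ ^ (1 / s))) = Real.exp (-(δ / 2 * ‖v‖ ^ (1 / s))) *
        Real.exp (-(δ / 2 * ‖v‖ ^ (1 / s))) := by
      rw [← Real.exp_add]; congr 1; ring
    calc ‖v‖ ^ k * ‖G v‖ ≤ ‖v‖ ^ k * (A * Real.exp (-(δ * ‖v‖ ^ (1 / s)))) := by
          gcongr; exact hGb v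
      _ = A * (‖v‖ ^ k * Real.exp (-(δ / 2 * ‖v‖ ^ (1 / s)))) *
            Real.exp (-(δ / 2 * ‖v‖ ^ (1 / s))) := by rw [h1]; ring
      _ ≤ _ := mul_le_mul_of_nonneg_right (mul_le_mul_of_nonneg_left
          (pow_mul_exp_le_gevrey hs (norm_nonneg v) (half_pos hδ) k) hA) (Real.exp_pos _).le
  have hE : Integrable (fun v : V => Real.exp (-(δ / 2 * ‖v‖ ^ (1 / s)))) μ :=
    integrable_exp_neg_norm_rpow hs (half_pos hδ)
  have hint : ∀ k : ℕ, Integrable (fun v => ‖v‖ ^ k * ‖G v‖) μ := by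
    intro k
    refine (hE.const_mul (A * (((s / (δ / 2)) ^ s) ^ k * (k.factorial : ℝ) ^ s))).mono'
      ((continuous_norm.pow k).aestronglyMeasurable.mul hG.norm)
      (Filter.Eventually.of_forall fun v => ?_)
    rw [Real.norm_of_nonneg (by positivity)]
    exact hbk k v
  refine ⟨VectorFourier.contDiff_fourierIntegral L fun n _ => hint n, fun w k => ?_⟩
  rw [VectorFourier.iteratedFDeriv_fourierIntegral (N := ⊤) L (fun n _ => hint n) hG le_top]
  refine (VectorFourier.norm_fourierIntegral_le_integral_norm _ _ _ _ _).trans ?_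
  have h1 : ∀ v, ‖VectorFourier.fourierPowSMulRight L G v k‖ ≤
      (2 * Real.pi * ‖L‖) ^ k * (A * (((s / (δ / 2)) ^ s) ^ k * (k.factorial : ℝ) ^ s)) *
        Real.exp (-(δ / 2 * ‖v‖ ^ (1 / s))) := by
    intro v
    refine (VectorFourier.norm_fourierPowSMulRight_le L G v k).trans ?_
    rw [mul_assoc ((2 * Real.pi * ‖L‖) ^ k), mul_assoc ((2 * Real.pi * ‖L‖) ^ k)]
    exact mul_le_mul_of_nonneg_left (hbk k v) (by positivity)
  refine (integral_mono_of_nonneg (Filter.Eventually.of_forall fun _ => norm_nonneg _)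
    (hE.const_mul _) (Filter.Eventually.of_forall h1)).trans (le_of_eq ?_)
  rw [integral_const_mul, mul_pow]
  ring

end FourierIntegrals

/-! ### From Gevrey norms back to bounds on Fréchet derivatives. -/

section GevreyNorms

variable {ι : Type*} [Fintype ι] {s : ℝ}

theorem norm_multiDeriv_le_gevreyNorm {h : ℝ} (hh : 0 < h) {K : Set (EuclideanSpace ℝ ι)}
    {f : EuclideanSpace ℝ ι → ℂ} (hf : gevreyNorm s h K f < ⊤) (α : ι → ℕ)
    {x : EuclideanSpace ℝ ι} (hx : x ∈ K) :
    ‖multiDeriv α f x‖ ≤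
      (gevreyNorm s h K f).toReal * (h ^ multiAbs α * (multiFactorial α : ℝ) ^ s) := by
  have hfac : 0 < multiFactorial α := Finset.prod_pos fun i _ => Nat.factorial_pos _
  have hpos : 0 < h ^ multiAbs α * (multiFactorial α : ℝ) ^ s := by positivity
  have h1 : ‖multiDeriv α f x‖ₑ / ENNReal.ofReal (h ^ multiAbs α * (multiFactorial α : ℝ) ^ s)
      ≤ gevreyNorm s h K f := by
    refine le_trans ?_ (le_iSup (fun α : ι → ℕ => (⨆ x ∈ K, ‖multiDeriv α f x‖ₑ) /
      ENNReal.ofReal (h ^ multiAbs α * (multiFactorial α : ℝ) ^ s)) α)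
    gcongr
    exact le_iSup₂ (f := fun x (_ : x ∈ K) => ‖multiDeriv α f x‖ₑ) x hx
  rw [ENNReal.div_le_iff (by simpa using hpos) ENNReal.ofReal_ne_top] at h1
  have h2 := ENNReal.toReal_mono (ENNReal.mul_ne_top hf.ne ENNReal.ofReal_ne_top) h1
  rwa [toReal_enorm, ENNReal.toReal_mul, ENNReal.toReal_ofReal hpos.le] at h2

/-- On the support α! ≤ |α|! applies, and expanding the vectors in the standard basis costs a factor
card ι + 1 in the radius; off the support all derivatives vanish, so the bound is global. -/
theorem gevreyBoundAt_of_gevreyNorm (hs : 0 ≤ s) {h : ℝ} (hh : 0 < h)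
    {K : Set (EuclideanSpace ℝ ι)} {f : EuclideanSpace ℝ ι → ℂ} (hfc : ContDiff ℝ ∞ f)
    (hfK : tsupport f ⊆ K) (hf : gevreyNorm s h K f < ⊤) (x : EuclideanSpace ℝ ι) :
    GevreyBoundAt s (gevreyNorm s h K f).toReal ((Fintype.card ι + 1 : ℝ) * h) f x := by
  by_cases hx : x ∈ tsupport f
  · intro k
    refine (norm_iteratedFDeriv_le_of_multiDeriv hfc x k
      (M := (gevreyNorm s h K f).toReal * (h ^ k * (k.factorial : ℝ) ^ s))
      (by positivity) fun α hα => ?_).trans (le_of_eq (by rw [mul_pow]; ring))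
    refine (norm_multiDeriv_le_gevreyNorm hh hf α (hfK hx)).trans ?_
    have := multiFactorial_le α
    rw [hα] at this ⊢
    gcongr
  · exact GevreyBoundAt.of_notMem_tsupport ENNReal.toReal_nonneg (by positivity) hx

end GevreyNorms

/-! ### Estimates for the trace formula. -/

section Trace

open scoped FourierTransform

variable {m n : ℕ} {s : ℝ}

theorem norm_joinPoint_sq (x : EuclideanSpace ℝ (Fin m)) (t : EuclideanSpace ℝ (Fin n)) :
    ‖joinPoint x t‖ ^ 2 = ‖x‖ ^ 2 + ‖t‖ ^ 2 := by
  simp [joinPoint, EuclideanSpace.norm_sq_eq, Fintype.sum_sum_type]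

/-- Pairs carry the maximum norm and joined points the Euclidean one; this bound and the next
transfer exponential weights between the two. -/
theorem norm_prod_le_norm_joinPoint
    (ζ : EuclideanSpace ℝ (Fin m) × EuclideanSpace ℝ (Fin n)) : ‖ζ‖ ≤ ‖joinPoint ζ.1 ζ.2‖ := by
  have h := norm_joinPoint_sq ζ.1 ζ.2
  refine max_le ?_ ?_
  · exact le_of_sq_le_sq (by nlinarith [sq_nonneg ‖ζ.2‖]) (norm_nonneg _)
  · exact le_of_sq_le_sq (by nlinarith [sq_nonneg ‖ζ.1‖]) (norm_nonneg _)

theorem norm_joinPoint_le_norm_prod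
    (ζ : EuclideanSpace ℝ (Fin m) × EuclideanSpace ℝ (Fin n)) :
    ‖joinPoint ζ.1 ζ.2‖ ≤ 2 * ‖ζ‖ := by
  have h := norm_joinPoint_sq ζ.1 ζ.2
  have h1 : ‖ζ.1‖ ≤ ‖ζ‖ := norm_fst_le ζ
  have h2 : ‖ζ.2‖ ≤ ‖ζ‖ := norm_snd_le ζ
  refine le_of_sq_le_sq ?_ (by positivity)
  nlinarith [norm_nonneg ζ.1, norm_nonneg ζ.2, norm_nonneg ζ]

theorem joinPoint_sub (x x' : EuclideanSpace ℝ (Fin m)) (t t' : EuclideanSpace ℝ (Fin n)) :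
    joinPoint x t - joinPoint x' t' = joinPoint (x - x') (t - t') := by
  ext i
  cases i <;> simp [joinPoint]

theorem smul_joinPoint (r : ℝ) (x : EuclideanSpace ℝ (Fin m)) (t : EuclideanSpace ℝ (Fin n)) :
    r • joinPoint x t = joinPoint (r • x) (r • t) := by
  ext i
  cases i <;> simp [joinPoint]

theorem norm_joinPoint_zero_right (x : EuclideanSpace ℝ (Fin m)) :
    ‖joinPoint x (0 : EuclideanSpace ℝ (Fin n))‖ = ‖x‖ := by
  have h := norm_joinPoint_sq x (0 : EuclideanSpace ℝ (Fin n))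
  rw [norm_zero] at h
  exact (sq_eq_sq₀ (norm_nonneg _) (norm_nonneg _)).1 (by linarith)

theorem norm_joinPoint_zero_left (t : EuclideanSpace ℝ (Fin n)) :
    ‖joinPoint (0 : EuclideanSpace ℝ (Fin m)) t‖ = ‖t‖ := by
  have h := norm_joinPoint_sq (0 : EuclideanSpace ℝ (Fin m)) t
  rw [norm_zero] at h
  exact (sq_eq_sq₀ (norm_nonneg _) (norm_nonneg _)).1 (by linarith)

theorem continuous_joinPoint : Continuous fun ζ :
    EuclideanSpace ℝ (Fin m) × EuclideanSpace ℝ (Fin n) => joinPoint ζ.1 ζ.2 := by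
  refine (PiLp.continuous_toLp 2 _).comp (continuous_pi fun i => ?_)
  cases i with
  | inl i => exact (PiLp.continuous_apply 2 _ i).comp continuous_fst
  | inr i => exact (PiLp.continuous_apply 2 _ i).comp continuous_snd

theorem exists_joinPoint_eq (y : EuclideanSpace ℝ (Fin m ⊕ Fin n)) :
    ∃ (x : EuclideanSpace ℝ (Fin m)) (t : EuclideanSpace ℝ (Fin n)), y = joinPoint x t := by
  refine ⟨WithLp.toLp 2 fun i => y (Sum.inl i), WithLp.toLp 2 fun i => y (Sum.inr i), ?_⟩
  ext i
  cases i <;> simp [joinPoint]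

variable {W : Set (EuclideanSpace ℝ (Fin m ⊕ Fin n))}

/-- Under the wave-front condition, `ℱ(lam u)` decays in a conic neighbourhood of the conormal
directions `(0, θ)`. -/
theorem exists_norm_fourierCutoff_joinPoint_le (hs : 1 < s) (u : Ultradistribution s W)
    (hWF : gevreyWaveFrontSet hs u ∩
      {p | ∃ (x : EuclideanSpace ℝ (Fin m)) (t θ : EuclideanSpace ℝ (Fin n)),
        joinPoint x t ∈ W ∧ θ ≠ 0 ∧ p = (joinPoint x t, joinPoint 0 θ)} = ∅)
    (lam : GevreyTest s W) :
    ∃ c C ε : ℝ, 0 < c ∧ 0 ≤ C ∧ 0 < ε ∧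
      ∀ (σ : EuclideanSpace ℝ (Fin m)) (θ : EuclideanSpace ℝ (Fin n)), ‖σ‖ < c * ‖θ‖ →
        ‖fourierCutoff hs u lam (joinPoint σ θ)‖ ≤
          C * Real.exp (-(ε * ‖joinPoint σ θ‖ ^ (1 / s))) := by
  set S : Set (EuclideanSpace ℝ (Fin m ⊕ Fin n)) :=
    (fun θ : EuclideanSpace ℝ (Fin n) => joinPoint (0 : EuclideanSpace ℝ (Fin m)) θ) ''
      Metric.sphere 0 1 with hS
  have hSc : IsCompact S := (isCompact_sphere _ _).image
    (continuous_joinPoint.comp (by fun_prop : Continuous fun θ : EuclideanSpace ℝ (Fin n) =>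
      ((0 : EuclideanSpace ℝ (Fin m)), θ)))
  obtain ⟨c, hc, C, ε, hC, hε, hb⟩ :=
    exists_decaysOn_coneOver_thickening (s := s) (g := fourierCutoff hs u lam) hSc (by
      rintro _ ⟨θ, hθ, rfl⟩
      have hθ1 : ‖θ‖ = 1 := by simpa using hθ
      refine exists_decaysOn_fourierCutoff hs u lam fun y hy => ?_
      obtain ⟨x, t, rfl⟩ := exists_joinPoint_eq y
      have hyW : joinPoint x t ∈ W := lam.2.2.2.1 hy
      have hθ0 : θ ≠ 0 := by
        rintro rfl
        simp at hθ1
      by_contra hreg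
      have hξ0 : joinPoint (0 : EuclideanSpace ℝ (Fin m)) θ ≠ 0 := by
        rw [← norm_ne_zero_iff, norm_joinPoint_zero_left, hθ1]
        exact one_ne_zero
      have hmem : (joinPoint x t, joinPoint (0 : EuclideanSpace ℝ (Fin m)) θ) ∈
          (∅ : Set (EuclideanSpace ℝ (Fin m ⊕ Fin n) × EuclideanSpace ℝ (Fin m ⊕ Fin n))) := by
        rw [← hWF]
        exact ⟨⟨hyW, hξ0, hreg⟩, x, t, θ, hyW, hθ0, rfl⟩
      exact hmem)
  refine ⟨c, C, ε, hc, hC, hε, fun σ θ hσθ => hb _ ?_⟩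
  have hθ : 0 < ‖θ‖ := by
    by_contra h
    have h0 : ‖θ‖ = 0 := le_antisymm (not_lt.1 h) (norm_nonneg _)
    rw [h0, mul_zero] at hσθ
    exact absurd hσθ (not_lt.2 (norm_nonneg _))
  -- After scaling by 1/|θ|, the distance to the conormal unit sphere is at most |σ|/|θ| < c.
  refine ⟨‖θ‖, hθ, joinPoint (‖θ‖⁻¹ • σ) (‖θ‖⁻¹ • θ), ?_, ?_⟩
  · rw [Metric.mem_thickening_iff]
    refine ⟨joinPoint 0 (‖θ‖⁻¹ • θ), ⟨_, ?_, rfl⟩, ?_⟩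
    · rw [mem_sphere_zero_iff_norm, norm_smul, norm_inv, norm_norm, inv_mul_cancel₀ hθ.ne']
    · rw [dist_eq_norm, joinPoint_sub, sub_self, sub_zero, norm_joinPoint_zero_right, norm_smul,
        norm_inv, norm_norm, inv_mul_lt_iff₀ hθ]
      linarith
  · rw [smul_joinPoint, smul_smul, smul_smul, mul_inv_cancel₀ hθ.ne', one_smul, one_smul]

theorem integral_mul_exp_inner_eq_fourier (φ : EuclideanSpace ℝ (Fin m) → ℂ)
    (σ : EuclideanSpace ℝ (Fin m)) :
    ∫ x : EuclideanSpace ℝ (Fin m), φ x * Complex.exp (Complex.I * (inner ℝ x σ : ℝ)) =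
      𝓕 φ (-(2 * Real.pi)⁻¹ • σ) := by
  rw [Real.fourier_eq']
  refine integral_congr_ae (Filter.Eventually.of_forall fun x => ?_)
  simp only [smul_eq_mul]
  rw [mul_comm]
  congr 2
  rw [inner_smul_right, mul_comm]
  congr 1
  have h : (-2 * Real.pi * (-(2 * Real.pi)⁻¹ * inner ℝ x σ) : ℝ) = inner ℝ x σ := by
    field_simp
  exact_mod_cast h.symm

/-- Exponential decay of the integrand of the trace formula, uniform in `t` and `φ`. -/
theorem exists_norm_traceIntegrand_le (hs : 1 < s) (u : Ultradistribution s W)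
    (hWF : gevreyWaveFrontSet hs u ∩
      {p | ∃ (x : EuclideanSpace ℝ (Fin m)) (t θ : EuclideanSpace ℝ (Fin n)),
        joinPoint x t ∈ W ∧ θ ≠ 0 ∧ p = (joinPoint x t, joinPoint 0 θ)} = ∅)
    (lam : GevreyTest s W) {B : Set (EuclideanSpace ℝ (Fin m))} (hB : Bornology.IsBounded B)
    {a : ℝ} (ha : 0 < a) :
    ∃ C δ : ℝ, 0 ≤ C ∧ 0 < δ ∧ ∀ (φ : GevreyTest s B) (A : ℝ), 0 ≤ A →
      (∀ x, GevreyBoundAt s A a (φ : EuclideanSpace ℝ (Fin m) → ℂ) x) → ∀ t ζ,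
        ‖traceIntegrand hs u lam t φ ζ‖ ≤ C * A * Real.exp (-(δ * ‖ζ‖ ^ (1 / s))) := by
  have hs0 : 0 < s := by linarith
  obtain ⟨c, C, ε, hc, hC, hε, hcone⟩ := exists_norm_fourierCutoff_joinPoint_le hs u hWF lam
  obtain ⟨C₁, δ₁, hC₁, hδ₁, hF⟩ := exists_norm_fourier_le_exp hs0 hB ha
  set M : ℝ := max 1 c⁻¹ with hM
  have hM0 : 0 < M := lt_max_of_lt_left one_pos
  -- Outside the cone |ζ| ≤ M|σ|, and the transform of φ is evaluated at -σ/2π; δ₂ is its decay rate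
  -- expressed in |ζ|.
  set δ₂ : ℝ := δ₁ * (1 / (2 * Real.pi * M)) ^ (1 / s) with hδ₂
  have hδ₂0 : 0 < δ₂ := by positivity
  -- With |joinPoint| ≤ 2|ζ|, the growth of ℱ(λu) uses up exactly half of δ₂.
  set ε₁ : ℝ := δ₂ / (2 * 2 ^ (1 / s)) with hε₁
  have hε₁0 : 0 < ε₁ := by positivity
  obtain ⟨D, hD, hgrow⟩ := exists_norm_fourierCutoff_le hs u lam hε₁0
  refine ⟨(C + D) * C₁, min ε (δ₂ / 2), by positivity, lt_min hε (half_pos hδ₂0),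
    fun φ A hA hφ t ζ => ?_⟩
  have hφF := hF φ φ.2.1 φ.2.2.1 φ.2.2.2.1 A hA hφ
  have hnorm : ‖traceIntegrand hs u lam t φ ζ‖ =
      ‖fourierCutoff hs u lam (joinPoint ζ.1 ζ.2)‖ *
        ‖𝓕 (φ : EuclideanSpace ℝ (Fin m) → ℂ) (-(2 * Real.pi)⁻¹ • ζ.1)‖ := by
    have h1 : ‖Complex.exp (Complex.I * (inner ℝ t ζ.2 : ℝ))‖ = 1 := by
      rw [mul_comm, Complex.norm_exp_ofReal_mul_I]
    rw [traceIntegrand, integral_mul_exp_inner_eq_fourier, norm_mul, norm_mul, h1, mul_one]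
  rw [hnorm]
  set w := ‖ζ‖ ^ (1 / s) with hw
  have hw0 : 0 ≤ w := by positivity
  by_cases hζ : ‖ζ.1‖ < c * ‖ζ.2‖
  · have h1 : ‖fourierCutoff hs u lam (joinPoint ζ.1 ζ.2)‖ ≤ C * Real.exp (-(ε * w)) := by
      refine (hcone _ _ hζ).trans (mul_le_mul_of_nonneg_left (Real.exp_le_exp.2 (neg_le_neg
        (mul_le_mul_of_nonneg_left ?_ hε.le))) hC)
      exact Real.rpow_le_rpow (norm_nonneg _) (norm_prod_le_norm_joinPoint ζ) (by positivity)
    have h2 : ‖𝓕 (φ : EuclideanSpace ℝ (Fin m) → ℂ) (-(2 * Real.pi)⁻¹ • ζ.1)‖ ≤ C₁ * A := by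
      refine (hφF _).trans (mul_le_of_le_one_right (by positivity) (Real.exp_le_one_iff.2 ?_))
      exact neg_nonpos.2 (by positivity)
    calc ‖fourierCutoff hs u lam (joinPoint ζ.1 ζ.2)‖ *
          ‖𝓕 (φ : EuclideanSpace ℝ (Fin m) → ℂ) (-(2 * Real.pi)⁻¹ • ζ.1)‖
        ≤ (C * Real.exp (-(ε * w))) * (C₁ * A) := by gcongr
      _ = (C * (C₁ * A)) * Real.exp (-(ε * w)) := by ring
      _ ≤ ((C + D) * C₁ * A) * Real.exp (-(min ε (δ₂ / 2) * w)) := by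
        refine mul_exp_le_mul_exp ?_ (by positivity) (min_le_left _ _) hw0
        rw [mul_assoc]
        exact mul_le_mul_of_nonneg_right (by linarith) (by positivity)
  · push Not at hζ
    have hζn : ‖ζ‖ ≤ M * ‖ζ.1‖ := by
      refine max_le ?_ ?_
      · exact le_mul_of_one_le_left (norm_nonneg _) (le_max_left _ _)
      · calc ‖ζ.2‖ ≤ c⁻¹ * ‖ζ.1‖ := by rw [le_inv_mul_iff₀ hc]; exact hζ
          _ ≤ M * ‖ζ.1‖ := mul_le_mul_of_nonneg_right (le_max_right _ _) (norm_nonneg _)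
    have h1 : ‖fourierCutoff hs u lam (joinPoint ζ.1 ζ.2)‖ ≤ D * Real.exp (δ₂ / 2 * w) := by
      refine (hgrow _).trans (mul_le_mul_of_nonneg_left (Real.exp_le_exp.2 ?_) hD)
      have h2 : ‖joinPoint ζ.1 ζ.2‖ ^ (1 / s) ≤ 2 ^ (1 / s) * w := by
        rw [hw, ← Real.mul_rpow (by norm_num) (norm_nonneg _)]
        exact Real.rpow_le_rpow (norm_nonneg _) (norm_joinPoint_le_norm_prod ζ) (by positivity)
      refine (mul_le_mul_of_nonneg_left h2 hε₁0.le).trans (le_of_eq ?_)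
      rw [hε₁]
      field_simp
    have h2 : ‖𝓕 (φ : EuclideanSpace ℝ (Fin m) → ℂ) (-(2 * Real.pi)⁻¹ • ζ.1)‖ ≤
        C₁ * A * Real.exp (-(δ₂ * w)) := by
      refine (hφF _).trans (mul_le_mul_of_nonneg_left (Real.exp_le_exp.2 (neg_le_neg ?_))
        (by positivity))
      rw [hδ₂, mul_assoc]
      refine mul_le_mul_of_nonneg_left ?_ hδ₁.le
      rw [hw, ← Real.mul_rpow (by positivity) (norm_nonneg _)]
      refine Real.rpow_le_rpow (by positivity) ?_ (by positivity)
      rw [norm_smul, norm_neg, Real.norm_of_nonneg (by positivity)]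
      calc 1 / (2 * Real.pi * M) * ‖ζ‖ ≤ 1 / (2 * Real.pi * M) * (M * ‖ζ.1‖) := by gcongr
        _ = (2 * Real.pi)⁻¹ * ‖ζ.1‖ := by field_simp
    calc ‖fourierCutoff hs u lam (joinPoint ζ.1 ζ.2)‖ *
          ‖𝓕 (φ : EuclideanSpace ℝ (Fin m) → ℂ) (-(2 * Real.pi)⁻¹ • ζ.1)‖
        ≤ (D * Real.exp (δ₂ / 2 * w)) * (C₁ * A * Real.exp (-(δ₂ * w))) := by gcongr
      _ = D * (C₁ * A) * Real.exp (-(δ₂ / 2 * w)) := by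
        have h3 : Real.exp (-(δ₂ / 2 * w)) = Real.exp (δ₂ / 2 * w) * Real.exp (-(δ₂ * w)) := by
          rw [← Real.exp_add]; congr 1; ring
        rw [h3]; ring
      _ ≤ ((C + D) * C₁ * A) * Real.exp (-(min ε (δ₂ / 2) * w)) := by
        refine mul_exp_le_mul_exp ?_ (by positivity) (min_le_right _ _) hw0
        rw [mul_assoc]
        exact mul_le_mul_of_nonneg_right (by linarith) (by positivity)

theorem integrable_mul_exp_inner {B : Set (EuclideanSpace ℝ (Fin m))} (φ : GevreyTest s B)
    (σ : EuclideanSpace ℝ (Fin m)) :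
    Integrable fun x : EuclideanSpace ℝ (Fin m) =>
      (φ : EuclideanSpace ℝ (Fin m) → ℂ) x * Complex.exp (Complex.I * (inner ℝ x σ : ℝ)) := by
  refine Continuous.integrable_of_hasCompactSupport (φ.2.1.continuous.mul ?_) φ.2.2.1.mul_right
  fun_prop

theorem continuous_traceIntegrand (hs : 1 < s) (u : Ultradistribution s W) (lam : GevreyTest s W)
    {B : Set (EuclideanSpace ℝ (Fin m))} (t : EuclideanSpace ℝ (Fin n)) (φ : GevreyTest s B) :
    Continuous (traceIntegrand hs u lam t (φ : EuclideanSpace ℝ (Fin m) → ℂ)) := by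
  unfold traceIntegrand
  simp only [integral_mul_exp_inner_eq_fourier]
  have h1 : Continuous (𝓕 (φ : EuclideanSpace ℝ (Fin m) → ℂ)) :=
    VectorFourier.fourierIntegral_continuous Real.continuous_fourierChar
      (show Continuous fun p : EuclideanSpace ℝ (Fin m) × EuclideanSpace ℝ (Fin m) =>
        inner ℝ p.1 p.2 from continuous_inner)
      (φ.2.1.continuous.integrable_of_hasCompactSupport φ.2.2.1)
  refine (((continuous_fourierCutoff hs u lam).comp continuous_joinPoint).mul ?_).mul
    (h1.comp (by fun_prop))
  fun_prop

theorem isAddHaarMeasure_volume_prod_euclideanSpace (m n : ℕ) :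
    (volume : Measure (EuclideanSpace ℝ (Fin m) × EuclideanSpace ℝ (Fin n))).IsAddHaarMeasure :=
  inferInstanceAs ((volume : Measure (EuclideanSpace ℝ (Fin m))).prod
    (volume : Measure (EuclideanSpace ℝ (Fin n)))).IsAddHaarMeasure

theorem integrable_traceIntegrand (hs : 1 < s) (u : Ultradistribution s W)
    (hWF : gevreyWaveFrontSet hs u ∩
      {p | ∃ (x : EuclideanSpace ℝ (Fin m)) (t θ : EuclideanSpace ℝ (Fin n)),
        joinPoint x t ∈ W ∧ θ ≠ 0 ∧ p = (joinPoint x t, joinPoint 0 θ)} = ∅)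
    (lam : GevreyTest s W) {B : Set (EuclideanSpace ℝ (Fin m))} (hB : Bornology.IsBounded B)
    (t : EuclideanSpace ℝ (Fin n)) (φ : GevreyTest s B) :
    Integrable (traceIntegrand hs u lam t φ) := by
  have hs0 : 0 < s := by linarith
  obtain ⟨A, a, hA, ha, hφ⟩ := GevreyTest.exists_gevreyBoundAt hs0.le φ
  obtain ⟨C, δ, hC, hδ, hb⟩ := exists_norm_traceIntegrand_le hs u hWF lam hB ha
  have := isAddHaarMeasure_volume_prod_euclideanSpace m n
  exact ((integrable_exp_neg_norm_rpow hs0 hδ).const_mul (C * A)).mono'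
    (continuous_traceIntegrand hs u lam t φ).aestronglyMeasurable
    (Filter.Eventually.of_forall fun ζ => hb φ A hA hφ t ζ)

/-- The real inner product as a continuous bilinear map. -/
noncomputable def innerBilin (n : ℕ) :
    EuclideanSpace ℝ (Fin n) →L[ℝ] EuclideanSpace ℝ (Fin n) →L[ℝ] ℝ := innerSL ℝ

theorem innerBilin_apply (x y : EuclideanSpace ℝ (Fin n)) : innerBilin n x y = inner ℝ x y := rfl

/-- The pairing `(ζ, t) ↦ -(2π)⁻¹ ⟨ζ.2, t⟩`. -/
noncomputable def tracePairing (m n : ℕ) :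
    (EuclideanSpace ℝ (Fin m) × EuclideanSpace ℝ (Fin n)) →L[ℝ]
      EuclideanSpace ℝ (Fin n) →L[ℝ] ℝ :=
  (-(2 * Real.pi)⁻¹) • (innerBilin n).comp (ContinuousLinearMap.snd ℝ _ _)

/-- All dependence on t sits in the character e^{i⟨t,θ⟩}, so the amplitude is the integrand at t = 0
and regularity in t follows from decay of the amplitude. -/
theorem traceFormula_eq_fourierIntegral (hs : 1 < s) (u : Ultradistribution s W)
    (lam : GevreyTest s W) (φ : EuclideanSpace ℝ (Fin m) → ℂ) :
    (fun t => traceFormula hs u lam t φ) = VectorFourier.fourierIntegral Real.fourierChar volume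
      (tracePairing m n).toLinearMap₁₂
      (fun ζ => ((2 * Real.pi : ℂ) ^ (m + n))⁻¹ * traceIntegrand hs u lam 0 φ ζ) := by
  funext t
  rw [traceFormula, ← integral_const_mul]
  refine integral_congr_ae (Filter.Eventually.of_forall fun ζ => ?_)
  have h1 : (Real.fourierChar (-(tracePairing m n).toLinearMap₁₂ ζ t) : ℂ) =
      Complex.exp (Complex.I * (inner ℝ t ζ.2 : ℝ)) := by
    rw [Real.fourierChar_apply]
    have h2 : (tracePairing m n).toLinearMap₁₂ ζ t = -(2 * Real.pi)⁻¹ * inner ℝ t ζ.2 := by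
      simp [tracePairing, innerBilin_apply, real_inner_comm]
    rw [h2]
    congr 1
    rw [mul_comm]
    congr 1
    have h3 : (2 * Real.pi * -(-(2 * Real.pi)⁻¹ * inner ℝ t ζ.2) : ℝ) = inner ℝ t ζ.2 := by
      field_simp
    exact_mod_cast h3
  simp only [Circle.smul_def, h1, smul_eq_mul, traceIntegrand, inner_zero_left, Complex.ofReal_zero,
    mul_zero, Complex.exp_zero, mul_one]
  ring

theorem contDiff_gevreyBoundAt_traceFormula (hs : 1 < s) (u : Ultradistribution s W)
    (hWF : gevreyWaveFrontSet hs u ∩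
      {p | ∃ (x : EuclideanSpace ℝ (Fin m)) (t θ : EuclideanSpace ℝ (Fin n)),
        joinPoint x t ∈ W ∧ θ ≠ 0 ∧ p = (joinPoint x t, joinPoint 0 θ)} = ∅)
    (lam : GevreyTest s W) {B : Set (EuclideanSpace ℝ (Fin m))} (hB : Bornology.IsBounded B)
    {a : ℝ} (ha : 0 < a) :
    ∃ C b : ℝ, 0 ≤ C ∧ 0 < b ∧ ∀ (φ : GevreyTest s B) (A : ℝ), 0 ≤ A →
      (∀ x, GevreyBoundAt s A a (φ : EuclideanSpace ℝ (Fin m) → ℂ) x) →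
        ContDiff ℝ ∞ (fun t => traceFormula hs u lam t φ) ∧
        ∀ t, GevreyBoundAt s (C * A) b (fun t => traceFormula hs u lam t φ) t := by
  have hs0 : 0 < s := by linarith
  obtain ⟨C, δ, hC, hδ, hb⟩ := exists_norm_traceIntegrand_le hs u hWF lam hB ha
  set κ : ℝ := ‖((2 * Real.pi : ℂ) ^ (m + n))⁻¹‖ with hκ
  set I : ℝ := ∫ ζ : EuclideanSpace ℝ (Fin m) × EuclideanSpace ℝ (Fin n),
    Real.exp (-(δ / 2 * ‖ζ‖ ^ (1 / s))) with hI
  have hI0 : 0 ≤ I := integral_nonneg fun _ => (Real.exp_pos _).le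
  set b₀ : ℝ := 2 * Real.pi * ‖tracePairing m n‖ * (s / (δ / 2)) ^ s with hb₀
  have hb₀0 : 0 ≤ b₀ := by positivity
  -- b₀ is zero when the pairing vanishes, as for n = 0; adding 1 makes the radius positive.
  refine ⟨κ * C * I, b₀ + 1, by positivity, by positivity, fun φ A hA hφ => ?_⟩
  have := isAddHaarMeasure_volume_prod_euclideanSpace m n
  have h := contDiff_gevreyBoundAt_fourierIntegral (μ := volume) (A := κ * C * A) hs0 hδ
    (tracePairing m n)
    (G := fun ζ => ((2 * Real.pi : ℂ) ^ (m + n))⁻¹ * traceIntegrand hs u lam 0 φ ζ)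
    (continuous_const.mul (continuous_traceIntegrand hs u lam 0 φ)).aestronglyMeasurable
    (fun ζ => by
      rw [norm_mul, mul_assoc κ, mul_assoc κ]
      exact mul_le_mul_of_nonneg_left (hb φ A hA hφ 0 ζ) (norm_nonneg _))
  rw [← traceFormula_eq_fourierIntegral] at h
  refine ⟨h.1, fun t => (h.2 t).mono (le_of_eq (by rw [hI]; ring)) hb₀0 (by linarith)
    (by positivity)⟩

theorem traceFormula_add (hs : 1 < s) (u : Ultradistribution s W)
    (hWF : gevreyWaveFrontSet hs u ∩
      {p | ∃ (x : EuclideanSpace ℝ (Fin m)) (t θ : EuclideanSpace ℝ (Fin n)),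
        joinPoint x t ∈ W ∧ θ ≠ 0 ∧ p = (joinPoint x t, joinPoint 0 θ)} = ∅)
    (lam : GevreyTest s W) {B : Set (EuclideanSpace ℝ (Fin m))} (hB : Bornology.IsBounded B)
    (t : EuclideanSpace ℝ (Fin n)) (φ ψ : GevreyTest s B) :
    traceFormula hs u lam t (φ + ψ : GevreyTest s B) =
      traceFormula hs u lam t φ + traceFormula hs u lam t ψ := by
  rw [traceFormula, traceFormula, traceFormula, ← mul_add, ← integral_add
    (integrable_traceIntegrand hs u hWF lam hB t φ) (integrable_traceIntegrand hs u hWF lam hB t ψ)]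
  congr 1
  refine integral_congr_ae (Filter.Eventually.of_forall fun ζ => ?_)
  simp only [traceIntegrand, Submodule.coe_add, Pi.add_apply, add_mul]
  rw [integral_add (integrable_mul_exp_inner φ ζ.1) (integrable_mul_exp_inner ψ ζ.1), mul_add]

theorem traceFormula_smul (hs : 1 < s) (u : Ultradistribution s W) (lam : GevreyTest s W)
    {B : Set (EuclideanSpace ℝ (Fin m))} (t : EuclideanSpace ℝ (Fin n)) (c : ℂ)
    (φ : GevreyTest s B) :
    traceFormula hs u lam t (c • φ : GevreyTest s B) = c * traceFormula hs u lam t φ := by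
  rw [traceFormula, traceFormula, mul_left_comm, ← integral_const_mul c]
  congr 1
  refine integral_congr_ae (Filter.Eventually.of_forall fun ζ => ?_)
  simp only [traceIntegrand, Submodule.coe_smul, Pi.smul_apply, smul_eq_mul, mul_assoc]
  rw [integral_const_mul]
  ring

end Trace

/-! ### The trace theorem. -/

theorem propositionB1 (m n : ℕ) (s R : ℝ) (hs : 1 < s) (hR : 0 < R)
    (W : Set (EuclideanSpace ℝ (Fin m ⊕ Fin n))) (hW : IsOpen W)
    (hVW : closure (ballProduct m n R) ⊆ W)
    (u : Ultradistribution s W)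
    (hWF : gevreyWaveFrontSet hs u ∩
      {p | ∃ (x : EuclideanSpace ℝ (Fin m)) (t θ : EuclideanSpace ℝ (Fin n)),
        joinPoint x t ∈ W ∧ θ ≠ 0 ∧ p = (joinPoint x t, joinPoint 0 θ)} = ∅)
    (lam : GevreyTest s W)
    (hlam : ∀ p ∈ ballProduct m n R, (lam : EuclideanSpace ℝ (Fin m ⊕ Fin n) → ℂ) p = 1) :
    -- the integral in the trace formula converges absolutely
    (∀ t ∈ Metric.ball (0 : EuclideanSpace ℝ (Fin n)) R,
      ∀ φ : GevreyTest s (Metric.ball (0 : EuclideanSpace ℝ (Fin m)) R),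
        Integrable (traceIntegrand hs u lam t φ)) ∧
    -- it defines an ultradistribution for each `t`
    (∀ t ∈ Metric.ball (0 : EuclideanSpace ℝ (Fin n)) R,
      ∃ T : Ultradistribution s (Metric.ball (0 : EuclideanSpace ℝ (Fin m)) R),
        ∀ φ : GevreyTest s (Metric.ball (0 : EuclideanSpace ℝ (Fin m)) R),
          T.toLinearMap φ = traceFormula hs u lam t φ) ∧
    -- for fixed `φ`, it is a Gevrey function of `t`
    (∀ φ : GevreyTest s (Metric.ball (0 : EuclideanSpace ℝ (Fin m)) R),
      IsGevreyOn s (Metric.ball (0 : EuclideanSpace ℝ (Fin n)) R)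
        (fun t => traceFormula hs u lam t φ)) ∧
    -- with estimates on the `t`-derivatives that are uniform in `t`, `β` and `φ`
    (∀ r : ℝ, 0 < r → ∃ (C : ℝ≥0) (b : ℝ), 0 < b ∧
      ∀ φ : GevreyTest s (Metric.ball (0 : EuclideanSpace ℝ (Fin m)) R),
        gevreyNorm s r (Metric.ball (0 : EuclideanSpace ℝ (Fin m)) R) φ < ⊤ →
          ∀ (β : Fin n → ℕ), ∀ t ∈ Metric.ball (0 : EuclideanSpace ℝ (Fin n)) R,
            ‖multiDeriv β (fun t' => traceFormula hs u lam t' φ) t‖ₑ ≤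
              C * gevreyNorm s r (Metric.ball (0 : EuclideanSpace ℝ (Fin m)) R) φ *
                ENNReal.ofReal (b ^ multiAbs β * ((multiAbs β).factorial : ℝ) ^ s)) := by
  have hs0 : 0 ≤ s := by linarith
  have hB : Bornology.IsBounded (Metric.ball (0 : EuclideanSpace ℝ (Fin m)) R) :=
    Metric.isBounded_ball
  -- C and b depend on r only. The set K is left free: a compact set for continuity in φ, `univ` for
  -- regularity in t, and the ball itself for the uniform estimate.
  have hest : ∀ r : ℝ, 0 < r → ∃ C b : ℝ, 0 ≤ C ∧ 0 < b ∧
      ∀ (K : Set (EuclideanSpace ℝ (Fin m)))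
        (φ : GevreyTest s (Metric.ball (0 : EuclideanSpace ℝ (Fin m)) R)),
        tsupport (φ : EuclideanSpace ℝ (Fin m) → ℂ) ⊆ K → gevreyNorm s r K φ < ⊤ →
          ContDiff ℝ ∞ (fun t => traceFormula hs u lam t φ) ∧ ∀ t,
            GevreyBoundAt s (C * (gevreyNorm s r K φ).toReal) b
              (fun t => traceFormula hs u lam t φ) t := by
    intro r hr
    obtain ⟨C, b, hC, hb, h⟩ := contDiff_gevreyBoundAt_traceFormula hs u hWF lam hB
      (a := (Fintype.card (Fin m) + 1 : ℝ) * r) (by positivity)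
    exact ⟨C, b, hC, hb, fun K φ hφK hφ => h φ _ ENNReal.toReal_nonneg
      (gevreyBoundAt_of_gevreyNorm hs0 hr φ.2.1 hφK hφ)⟩
  refine ⟨fun t _ φ => integrable_traceIntegrand hs u hWF lam hB t φ, fun t _ => ?_, fun φ => ?_,
    fun r hr => ?_⟩
  · refine ⟨⟨⟨⟨fun φ => traceFormula hs u lam t φ, traceFormula_add hs u hWF lam hB t⟩,
      traceFormula_smul hs u lam t⟩, fun K _ _ h hh => ?_⟩, fun φ => rfl⟩
    obtain ⟨C, b, hC, hb, hbd⟩ := hest h hh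
    lift C to ℝ≥0 using hC
    refine ⟨C, fun φ hφK hφ => ?_⟩
    -- The Gevrey bound of order zero in t is the continuity estimate in φ.
    have h1 := (hbd K φ hφK hφ).2 t 0
    rw [norm_iteratedFDeriv_zero, pow_zero, Nat.factorial_zero, Nat.cast_one, Real.one_rpow,
      mul_one, mul_one] at h1
    rw [← ENNReal.ofReal_toReal hφ.ne, ← ENNReal.ofReal_coe_nnreal, ← ENNReal.ofReal_mul C.coe_nonneg,
      ← ofReal_norm]
    exact ENNReal.ofReal_le_ofReal h1
  · obtain ⟨h, hh, hφ⟩ := φ.2.2.2.2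
    obtain ⟨C, b, hC, hb, hbd⟩ := hest h hh
    obtain ⟨hsmooth, hbd'⟩ := hbd univ φ (subset_univ _) hφ
    exact ⟨hsmooth.contDiffOn, fun K _ _ => ⟨_, by positivity,
      (gevreyNorm_le_of_gevreyBoundAt hs0 (by positivity) hb fun t _ => hbd' t).trans_lt
        ENNReal.ofReal_lt_top⟩⟩
  · obtain ⟨C, b, hC, hb, hbd⟩ := hest r hr
    lift C to ℝ≥0 using hC
    refine ⟨C, b, hb, fun φ hφ β t _ => ?_⟩
    have h1 := (norm_multiDeriv_le β (fun t' => traceFormula hs u lam t' φ) t).trans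
      ((hbd _ φ φ.2.2.2.1 hφ).2 t _)
    rw [← ENNReal.ofReal_toReal hφ.ne, ← ENNReal.ofReal_coe_nnreal, ← ENNReal.ofReal_mul C.coe_nonneg,
      ← ENNReal.ofReal_mul (by positivity), ← ofReal_norm]
    exact ENNReal.ofReal_le_ofReal h1
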